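/- \textbf{Lemma (Weak measure concentration).} Let $G=(V,E)$ be a finite simple undirected graph with pairwise disjoint sets of boundary vertices $A,B,C\subset V$, $\partial=A\sqcup B\sqcup C$, $AB=A\sqcup B$, and fixed edge weights $w(e)\ge 0$. For $r\subset V$ let $\mathcal A(r)=\sum_{e}w(e)$, summed over the edges $e$ with one vertex in $r$ and one in $r^c$. A cut for $AB:C$ is a set $r\subset V$ with $AB\subset r$ and $C\subset r^c$, and $\mathcal A(AB:C)$ is the minimum of $\mathcal A(r)$ over these cuts. Assume that the entanglement wedge of $AB$ is unique with gap $g>0$: there is a cut $r_{AB}$ for $AB:C$ with $\mathcal A(r_{AB})=\mathcal A(AB:C)$, and every other cut $r\ne r_{AB}$ for $AB:C$ satisfies $\mathcal A(AB:C)\le \mathcal A(r)-g$. For $\chi>1$ let the edges have integer bond dimensions $\chi(e)\ge 1$ with $w(e)=\ln\chi(e)/\ln\chi$. Put $\mathcal H^v=\bigotimes_{e\ni v}\mathbb C^{\chi(e)}$, and for each edge $e=\{v_1,v_2\}$ let $|\Psi_e\rangle\in\mathbb C^{\chi(e)}\otimes\mathbb C^{\chi(e)}$ be a maximally entangled state between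 its copies of $\mathbb C^{\chi(e)}$ at $v_1$ and $v_2$. Pick independent Haar random unit vectors $T(v)\in\mathcal H^v$, $v\in V\setminus\partial$, and let \[ |\psi\rangle\ \propto\ \Big(\bigotimes_{v\in V\setminus\partial}\langle T(v)|\Big)\Big(\bigotimes_{e\in E}|\Psi_e\rangle\Big)\ \in\ \bigotimes_{v\in\partial}\mathcal H^v \] be the normalized random tensor network state, $\rho_{AB}=\mathrm{Tr}_C|\psi\rangle\langle\psi|$, and $\pi_{\rho_{AB}}$ the orthogonal projection onto the support of $\rho_{AB}$. Then \[ \mathbb E\,\Big\|\rho_{AB}-\pi_{\rho_{AB}}/\chi^{\mathcal A(AB:C)}\Big\|_1=\mathcal O\big(\chi^{-g/2}\big), \] where $\|\cdot\|_1$ is the trace norm: that is, the random variable on the left is integrable and there is a constant $K$, depending only on $G,A,B,C,w,g$, such that its expectation is at most $K\chi^{-g/2}$ for all $\chi>1$, all such bond dimensions $\chi(e)$ and all such states $|\Psi_e\rangle$. -/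

import Mathlib

open MeasureTheory

noncomputable section

namespace RTN

/-! ### Matrices: trace norm and support projection -/

section Matrices

variable {ι : Type*} [Fintype ι] [DecidableEq ι]

/-- The trace norm `‖M‖₁`, i.e. the sum of the singular values of `M`. -/
def traceNorm (M : Matrix ι ι ℂ) : ℝ :=
  (Matrix.toEuclideanLin M).singularValues.sum fun _ s => s

/-- The (matrix of the) orthogonal projection onto the support of `M`, the support being
the orthogonal complement of the kernel. -/
def supportProj (M : Matrix ι ι ℂ) : Matrix ι ι ℂ :=
  (Matrix.toEuclideanCLM (n := ι) (𝕜 := ℂ)).symm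
    ((LinearMap.ker (Matrix.toEuclideanLin M))ᗮ.starProjection)

end Matrices

/-! ### Haar random vectors -/

section Haar

variable (ι : Type*) [Fintype ι] [DecidableEq ι]

instance compactSpace_unitaryGroup : CompactSpace (Matrix.unitaryGroup ι ℂ) := by
  have hK : IsCompact (Set.univ.pi fun _ : ι => Set.univ.pi fun _ : ι =>
      Metric.closedBall (0 : ℂ) 1) :=
    isCompact_univ_pi fun _ => isCompact_univ_pi fun _ => isCompact_closedBall _ _
  have h : IsCompact (Matrix.unitaryGroup ι ℂ : Set (Matrix ι ι ℂ)) := by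
    refine IsCompact.of_isClosed_subset (X := Matrix ι ι ℂ) hK
      (isClosed_unitary (R := Matrix ι ι ℂ)) ?_
    intro U hU i _ j _
    simpa using entry_norm_bound_of_unitary hU i j
  exact isCompact_iff_compactSpace.mp h

instance measurableSpace_unitaryGroup : MeasurableSpace (Matrix.unitaryGroup ι ℂ) :=
  borel _

instance borelSpace_unitaryGroup : BorelSpace (Matrix.unitaryGroup ι ℂ) := ⟨rfl⟩

/-- The law of a Haar random unit vector of `ℂ^ι`: the vector `U e` where `U` is distributed
according to the Haar probability measure of the unitary group and `e` is a fixed vector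
of the standard basis. -/
def haarVector [Nonempty ι] : Measure (ι → ℂ) :=
  (Measure.haarMeasure (⊤ : TopologicalSpace.PositiveCompacts (Matrix.unitaryGroup ι ℂ))).map
    fun U : Matrix.unitaryGroup ι ℂ => Matrix.mulVec (U : Matrix ι ι ℂ) (Pi.single (Classical.arbitrary ι) 1)

end Haar

/-! ### Cuts -/

section Cuts

variable {V : Type*} [Fintype V] [DecidableEq V] (G : SimpleGraph V) [DecidableRel G.Adj]

/-- The cut surface of `r`: the edges that have a vertex in `r` and a vertex outside `r`. -/
def cutSurface (r : Finset V) : Finset G.edgeSet :=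
  Finset.univ.filter fun e => (∃ x ∈ r, x ∈ (e : Sym2 V)) ∧ ∃ y ∈ rᶜ, y ∈ (e : Sym2 V)

/-- The area of a region `r`: the total weight of its cut surface. -/
def area (w : G.edgeSet → ℝ) (r : Finset V) : ℝ :=
  ∑ e ∈ cutSurface G r, w e

/-- `r` is a cut for `S : S'`. -/
def IsCut (S S' r : Finset V) : Prop :=
  S ⊆ r ∧ S' ⊆ rᶜ

/-- The area of a minimal cut for `S : S'`, for disjoint sets of vertices `S` and `S'`. -/
def minCut (w : G.edgeSet → ℝ) (S S' : Finset V) : ℝ :=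
  ⨅ r : {r : Finset V // IsCut S S' r}, area G w r

/-- `r₀` is the entanglement wedge of `S` (a minimal cut for `S : S'`), and it is unique with
gap `g`. -/
def IsUniqueEntanglementWedge (w : G.edgeSet → ℝ) (S S' : Finset V) (g : ℝ)
    (r₀ : Finset V) : Prop :=
  IsCut S S' r₀ ∧ area G w r₀ = minCut G w S S' ∧
    ∀ r : Finset V, IsCut S S' r → r ≠ r₀ → minCut G w S S' ≤ area G w r - g

end Cuts

/-! ### Random tensor network states -/

section States

variable {V : Type*} [Fintype V] [DecidableEq V] {G : SimpleGraph V} [DecidableRel G.Adj]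

/-- Labels of the standard basis of `ℋ^v`, the tensor product of the spaces `ℂ^χ(e)` over the
edges `e` that contain `v`; the bond dimensions are `D e = χ(e)`. -/
abbrev VIdx (D : G.edgeSet → ℕ+) (v : V) : Type _ :=
  (e : {e : G.edgeSet // v ∈ (e : Sym2 V)}) → Fin (D e.1 : ℕ)

/-- Labels of the standard basis of the tensor product of the `ℋ^v` over `v ∈ S`. -/
abbrev RIdx (D : G.edgeSet → ℕ+) (S : Finset V) : Type _ :=
  (v : S) → VIdx D v

/-- Labels of the standard basis of the tensor product of the two copies of `ℂ^χ(e)` that sit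
at the two vertices of `e`. -/
abbrev EIdx (D : G.edgeSet → ℕ+) (e : G.edgeSet) : Type _ :=
  {v : V // v ∈ (e : Sym2 V)} → Fin (D e : ℕ)

/-- `Ψ` is a maximally entangled state of the two vertices of the edge `e`: both its reduced
density matrices are the identity divided by `χ(e)`. -/
def IsMaxEntangled (D : G.edgeSet → ℕ+) (e : G.edgeSet) (Ψ : EIdx D e → ℂ) : Prop :=
  ∀ (x : {v : V // v ∈ (e : Sym2 V)}) (i i' : Fin (D e : ℕ)),
    ∑ j : Fin (D e : ℕ), Ψ (fun v => if v = x then i else j) *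
        star (Ψ fun v => if v = x then i' else j)
      = if i = i' then ((D e : ℕ) : ℂ)⁻¹ else 0

/-- The vertices that are not boundary vertices. -/
abbrev Bulk (bd : Finset V) : Type _ := {v : V // v ∉ bd}

/-- A choice of tensors `T(v) ∈ ℋ^v`, one for each non-boundary vertex. -/
abbrev Tensors (D : G.edgeSet → ℕ+) (bd : Finset V) : Type _ :=
  (v : Bulk bd) → VIdx D v.1 → ℂ

/-- The law of independent Haar random tensors at the non-boundary vertices. -/
def haarTensors (D : G.edgeSet → ℕ+) (bd : Finset V) : Measure (Tensors D bd) :=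
  Measure.pi fun v : Bulk bd => haarVector (VIdx D v.1)

/-- The unnormalized state `(⨂_v ⟨T(v)|) (⨂_e |Ψ_e⟩)` in the boundary Hilbert space. The sum
runs over all assignments of labels to the half-edges with boundary part `b`. -/
def unnormalizedState (D : G.edgeSet → ℕ+) (Ψ : (e : G.edgeSet) → EIdx D e → ℂ)
    (bd : Finset V) (T : Tensors D bd) : RIdx D bd → ℂ := fun b =>
  ∑ x : (v : V) → VIdx D v,
    if (∀ v : bd, x v = b v) then
      (∏ v : Bulk bd, star (T v (x v.1))) *
        ∏ e : G.edgeSet, Ψ e fun v => x v.1 ⟨e, v.2⟩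
    else 0

/-- The random tensor network state: the normalization of `unnormalizedState`. -/
def state (D : G.edgeSet → ℕ+) (Ψ : (e : G.edgeSet) → EIdx D e → ℂ)
    (bd : Finset V) (T : Tensors D bd) : RIdx D bd → ℂ := fun b =>
  unnormalizedState D Ψ bd T b /
    (Real.sqrt (∑ b', ‖unnormalizedState D Ψ bd T b'‖ ^ 2) : ℂ)

/-- Juxtaposition of labels of `S` and of `S'` (for disjoint `S` and `S'`). -/
def glue {D : G.edgeSet → ℕ+} {S S' : Finset V} (a : RIdx D S) (c : RIdx D S') :
    RIdx D (S ∪ S') := fun v =>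
  if h : v.1 ∈ S then a ⟨v.1, h⟩
  else c ⟨v.1, (Finset.mem_union.mp v.2).resolve_left h⟩

/-- The reduced density matrix on `S` of the random tensor network state with boundary
`S ⊔ S'`: the partial trace of `|ψ⟩⟨ψ|` over `S'`. -/
def reducedDensity (D : G.edgeSet → ℕ+) (Ψ : (e : G.edgeSet) → EIdx D e → ℂ)
    (S S' : Finset V) (T : Tensors D (S ∪ S')) : Matrix (RIdx D S) (RIdx D S) ℂ :=
  Matrix.of fun a a' =>
    ∑ c : RIdx D S', state D Ψ (S ∪ S') T (glue a c) * star (state D Ψ (S ∪ S') T (glue a' c))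

end States

end RTN

end

/-!
Let `R = χ ^ 𝒜(AB:C)`. A density matrix `ρ` of rank at most `R` with support projection `π` satisfies
`‖ρ - π / R‖₁² ≤ R tr ρ² - 1`, by Cauchy-Schwarz on the support
(`traceNorm_sub_smul_supportProj_bounds`), so the reduced state is close to flat as soon as its
rank is at most `R` and its purity is not much larger than `1 / R`. The rank bound holds for every
choice of tensors, since the network factors through the bonds cut by the entanglement wedge, whose
dimensions multiply to `R` (`rank_stateMatrix_le`).

The purity is controlled on average. Both the purity of the unnormalized reduced state and its squared
trace are expectations of a swap of a boundary region `S` in two copies of the state (`swapMoment`,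
with `S = AB` and `S = ∅`). By the second moment of a Haar random vector
(`integral_haarVector_four`), which is the identity plus the swap up to a factor, averaging turns
them into a sum over all regions `S ∪ r` with `r` in the bulk, and because the bonds are maximally
entangled the summand is `χ ^ (-𝒜(S ∪ r))` (`integral_swapMoment`, `sum_swap_bondAmplitude`). For
`S = AB` the regions are the cuts for `AB:C`, so that the sum is `(1 + O(χ ^ (-g))) / R`. For
`S = ∅` the empty region contributes `1`, and every other one is a nonempty bulk region, whose area
is at least `g` because flipping it in the entanglement wedge gives another cut
(`IsUniqueEntanglementWedge.gap_le_area`). Hence the squared norm, divided by its mean, has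
variance `O(χ ^ (-g))`.

Finally let `X` be the trace distance in question and `ν` the squared norm divided by its mean. Then
`X = ν X + (1 - ν) X`, where `(ν X)²` is bounded by the difference of the two second moments and
`X ≤ 2`; linearizing the two square roots at the scale `χ ^ (-g / 2)` gives the claim
(`integral_traceNorm_le`). Measurability of `X` is not immediate, as `π` is a discontinuous function of
`ρ`; it follows by approximating the spectral function that defines `X` by polynomials
(`measurable_traceNorm_sub_smul_supportProj`).
-/

noncomputable section

open scoped Matrix ComplexOrder

namespace RTN

/-! ### Trace norm and support projection of Hermitian matrices -/

section Spectral

variable {ι : Type*} [Fintype ι] [DecidableEq ι]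

/-- The Hermitian matrix `U diag(f) U*` with real eigenvalues `f` in the orthonormal basis given by
the columns of `U`. -/
def conjDiag (U : Matrix ι ι ℂ) (f : ι → ℝ) : Matrix ι ι ℂ :=
  U * Matrix.diagonal (fun i => (f i : ℂ)) * star U

theorem conjDiag_mul {U : Matrix ι ι ℂ} (hU : U ∈ Matrix.unitaryGroup ι ℂ) (a b : ι → ℝ) :
    conjDiag U a * conjDiag U b = conjDiag U (fun i => a i * b i) := by
  have hUU : star U * U = 1 := (Matrix.mem_unitaryGroup_iff').mp hU
  calc _ = U * Matrix.diagonal (fun i => (a i : ℂ)) * (star U * U) *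
      (Matrix.diagonal (fun i => (b i : ℂ)) * star U) := by
        simp only [conjDiag, Matrix.mul_assoc]
    _ = _ := by
      rw [hUU, Matrix.mul_one, ← Matrix.mul_assoc, Matrix.mul_assoc U, Matrix.diagonal_mul_diagonal]
      simp [conjDiag]

theorem conjDiag_conjTranspose (U : Matrix ι ι ℂ) (f : ι → ℝ) : (conjDiag U f)ᴴ = conjDiag U f := by
  rw [conjDiag, Matrix.conjTranspose_mul, Matrix.conjTranspose_mul, Matrix.diagonal_conjTranspose]
  simp [Matrix.star_eq_conjTranspose, Matrix.mul_assoc, Pi.star_def]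

theorem conjDiag_sub_smul (U : Matrix ι ι ℂ) (a b : ι → ℝ) (c : ℝ) :
    conjDiag U a - (c : ℂ) • conjDiag U b = conjDiag U (fun i => a i - c * b i) := by
  unfold conjDiag
  rw [← Matrix.smul_mul, ← Matrix.mul_smul, ← Matrix.sub_mul, ← Matrix.mul_sub,
    ← Matrix.diagonal_smul, Matrix.diagonal_sub]
  simp

theorem conjDiag_pow {U : Matrix ι ι ℂ} (hU : U ∈ Matrix.unitaryGroup ι ℂ) (f : ι → ℝ) (k : ℕ) :
    conjDiag U f ^ k = conjDiag U (fun i => f i ^ k) := by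
  induction k with
  | zero => simp [conjDiag, (Matrix.mem_unitaryGroup_iff).mp hU]
  | succ k ih => simp [pow_succ, ih, conjDiag_mul hU]

theorem trace_conjDiag {U : Matrix ι ι ℂ} (hU : U ∈ Matrix.unitaryGroup ι ℂ) (f : ι → ℝ) :
    (conjDiag U f).trace = ((∑ i, f i : ℝ) : ℂ) := by
  rw [conjDiag, Matrix.trace_mul_comm, ← Matrix.mul_assoc, (Matrix.mem_unitaryGroup_iff').mp hU,
    Matrix.one_mul, Matrix.trace_diagonal]
  simp

theorem traceNorm_conjDiag {U : Matrix ι ι ℂ} (hU : U ∈ Matrix.unitaryGroup ι ℂ) (f : ι → ℝ) :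
    traceNorm (conjDiag U f) = ∑ i, |f i| := by
  set M := conjDiag U f with hM
  have hUU : star U * U = 1 := (Matrix.mem_unitaryGroup_iff').mp hU
  set T := Matrix.toEuclideanLin M with hT
  have hsum : traceNorm M = ∑ i : Fin (Module.finrank ℂ (EuclideanSpace ℂ ι)),
      √(T.isSymmetric_adjoint_comp_self.eigenvalues rfl i) := by
    unfold traceNorm LinearMap.singularValues
    rw [Finsupp.sum_embDomain, Finsupp.sum_fintype _ _ (fun _ => rfl)]
    rfl
  have hcomp : T.adjoint ∘ₗ T = Matrix.toEuclideanLin (Mᴴ * M) := by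
    rw [hT, ← Matrix.toEuclideanLin_conjTranspose_eq_adjoint]
    ext v : 1
    simp
  have hMM : Mᴴ * M = conjDiag U (fun i => f i ^ 2) := by
    rw [hM, conjDiag_conjTranspose, conjDiag_mul hU]
    simp [pow_two]
  have hchar : (T.adjoint ∘ₗ T).charpoly =
      ∏ i, (Polynomial.X - Polynomial.C ((f i ^ 2 : ℝ) : ℂ)) := by
    rw [hcomp, Matrix.toEuclideanLin, Matrix.toLpLin_eq_toLin, Matrix.charpoly_toLin, hMM, conjDiag,
      Matrix.charpoly_mul_comm, ← Matrix.mul_assoc, hUU, Matrix.one_mul, Matrix.charpoly_diagonal]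
  have hroots := T.isSymmetric_adjoint_comp_self.roots_charpoly_eq_eigenvalues rfl
  rw [hchar, Polynomial.roots_prod _ _
    (Finset.prod_ne_zero_iff.mpr fun _ _ => Polynomial.X_sub_C_ne_zero _)] at hroots
  simp only [Polynomial.roots_X_sub_C, Multiset.bind_singleton] at hroots
  have := congrArg (fun s => (s.map (fun z : ℂ => √z.re)).sum) hroots
  simp only [Multiset.map_map, Function.comp_def, Complex.ofReal_re, Real.sqrt_sq_eq_abs] at this
  exact hsum.trans this.symm

theorem supportProj_conjDiag {U : Matrix ι ι ℂ} (hU : U ∈ Matrix.unitaryGroup ι ℂ) (f : ι → ℝ) :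
    supportProj (conjDiag U f) = conjDiag U (fun i => if f i = 0 then 0 else 1) := by
  set M := conjDiag U f with hM
  set Q := conjDiag U (fun i => if f i = 0 then 0 else 1) with hQ
  have hMQ : M * Q = M := by
    rw [hM, hQ, conjDiag_mul hU]; congr! 2; split_ifs with h <;> simp [h]
  obtain ⟨N, hN⟩ : ∃ N, Q = N * M := by
    refine ⟨conjDiag U (fun i => (f i)⁻¹), ?_⟩
    rw [hM, hQ, conjDiag_mul hU]; congr! 2; split_ifs with h <;> simp [h]
  unfold supportProj
  rw [StarAlgEquiv.symm_apply_eq]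
  ext1 v
  apply Submodule.eq_starProjection_of_mem_orthogonal
  · rw [Submodule.mem_orthogonal]
    intro u hu
    have hu' : Matrix.toEuclideanLin Q u = 0 := by
      rw [hN, Matrix.toLpLin_mul_same, LinearMap.comp_apply, LinearMap.mem_ker.mp hu, map_zero]
    have h := LinearMap.adjoint_inner_left (Matrix.toEuclideanLin Q) v u
    rw [← Matrix.toEuclideanLin_conjTranspose_eq_adjoint, hQ, conjDiag_conjTranspose, ← hQ, hu',
      inner_zero_left] at h
    exact h.symm
  · rw [Submodule.orthogonal_orthogonal, LinearMap.mem_ker]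
    have : Matrix.toEuclideanCLM (n := ι) (𝕜 := ℂ) Q v = Matrix.toEuclideanLin Q v := rfl
    rw [this, map_sub, ← LinearMap.comp_apply, ← Matrix.toLpLin_mul_same, hMQ, sub_self]

theorem exists_eq_conjDiag {A : Matrix ι ι ℂ} (hA : A.IsHermitian) :
    ∃ U ∈ Matrix.unitaryGroup ι ℂ, A = conjDiag U hA.eigenvalues := by
  refine ⟨hA.eigenvectorUnitary, hA.eigenvectorUnitary.2, ?_⟩
  conv_lhs => rw [hA.spectral_theorem]
  rfl

/-- `A` and its support projection are diagonal in the same basis, so the trace norm is a spectral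
sum. -/
theorem traceNorm_sub_smul_supportProj {A : Matrix ι ι ℂ} (hA : A.IsHermitian) (c : ℝ) :
    traceNorm (A - (c : ℂ) • supportProj A) =
      ∑ i, |hA.eigenvalues i - c * if hA.eigenvalues i = 0 then 0 else 1| := by
  obtain ⟨U, hU, h⟩ := exists_eq_conjDiag hA
  have : traceNorm (conjDiag U hA.eigenvalues - (c : ℂ) • supportProj (conjDiag U hA.eigenvalues)) =
      ∑ i, |hA.eigenvalues i - c * if hA.eigenvalues i = 0 then 0 else 1| := by
    rw [supportProj_conjDiag hU, conjDiag_sub_smul, traceNorm_conjDiag hU]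
  rwa [← h] at this

theorem trace_pow_eq_sum_eigenvalues {A : Matrix ι ι ℂ} (hA : A.IsHermitian) (k : ℕ) :
    (A ^ k).trace = ((∑ i, hA.eigenvalues i ^ k : ℝ) : ℂ) := by
  obtain ⟨U, hU, h⟩ := exists_eq_conjDiag hA
  have : (conjDiag U hA.eigenvalues ^ k).trace = ((∑ i, hA.eigenvalues i ^ k : ℝ) : ℂ) := by
    rw [conjDiag_pow hU, trace_conjDiag hU]
  rwa [← h] at this

/-- The spectral sum of the discontinuous function `x ↦ |x - c 1_{x ≠ 0}|` is a pointwise limit of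
spectral sums of polynomials, and those are polynomials in the entries of the matrix. -/
theorem measurable_traceNorm_sub_smul_supportProj {α : Type*} [MeasurableSpace α]
    (M : α → Matrix ι ι ℂ) (hM : ∀ i j, Measurable fun a => M a i j)
    (hH : ∀ a, (M a).IsHermitian) (h01 : ∀ a i, (hH a).eigenvalues i ∈ Set.Icc (0 : ℝ) 1) (c : ℝ) :
    Measurable fun a => traceNorm (M a - (c : ℂ) • supportProj (M a)) := by
  -- `min (n x) 1` is continuous and tends to the indicator of `x ≠ 0` on `[0, 1]`.
  set F : ℕ → ℝ → ℝ := fun n x => |x - c * min (n * x) 1| with hF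
  have hFc : ∀ n, Continuous (F n) := fun n => by rw [hF]; fun_prop
  choose p hp using fun n : ℕ => exists_polynomial_near_of_continuousOn 0 1 (F n)
    (hFc n).continuousOn (1 / ((n : ℝ) + 1)) Nat.one_div_pos_of_nat
  have hlim : ∀ x ∈ Set.Icc (0 : ℝ) 1, Filter.Tendsto (fun n => (p n).eval x) Filter.atTop
      (nhds |x - c * if x = 0 then 0 else 1|) := by
    intro x hx
    have h1 : Filter.Tendsto (fun n => F n x) Filter.atTop
        (nhds |x - c * if x = 0 then 0 else 1|) := by
      apply tendsto_const_nhds.congr'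
      rcases eq_or_lt_of_le hx.1 with h0 | h0
      · filter_upwards with n
        simp [hF, ← h0]
      · obtain ⟨N, hN⟩ := exists_nat_gt (1 / x)
        filter_upwards [Filter.eventually_ge_atTop N] with n hn
        have : 1 ≤ n * x := by
          rw [div_lt_iff₀ h0] at hN
          have : (N : ℝ) ≤ n := by exact_mod_cast hn
          nlinarith
        simp [hF, h0.ne', min_eq_right this]
    have h2 : Filter.Tendsto (fun n => (p n).eval x - F n x) Filter.atTop (nhds 0) :=
      squeeze_zero_norm (fun n => (hp n x hx).le) tendsto_one_div_add_atTop_nhds_zero_nat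
    simpa using h2.add h1
  have hpow : ∀ (k : ℕ) i j, Measurable fun a => (M a ^ k) i j := by
    intro k
    induction k with
    | zero => intro i j; simp
    | succ k ih =>
      intro i j
      simp only [pow_succ, Matrix.mul_apply]
      exact Finset.measurable_sum _ fun l _ => (ih i l).mul (hM l j)
  have htr : ∀ (q : Polynomial ℝ) a, ∑ i, q.eval ((hH a).eigenvalues i) =
      ∑ k ∈ Finset.range (q.natDegree + 1), q.coeff k * (M a ^ k).trace.re := by
    intro q a
    simp_rw [Polynomial.eval_eq_sum_range, trace_pow_eq_sum_eigenvalues (hH a), Complex.ofReal_re]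
    rw [Finset.sum_comm]
    simp_rw [Finset.mul_sum]
  refine measurable_of_tendsto_metrizable (f := fun n a => ∑ k ∈ Finset.range ((p n).natDegree + 1),
    (p n).coeff k * (M a ^ k).trace.re) (fun n => ?_) ?_
  · refine Finset.measurable_sum _ fun k _ => Measurable.const_mul ?_ _
    exact Complex.measurable_re.comp (Finset.measurable_sum _ fun i _ => hpow k i i)
  · rw [tendsto_pi_nhds]
    intro a
    simp_rw [traceNorm_sub_smul_supportProj (hH a), ← htr]
    exact tendsto_finsetSum _ fun i _ => hlim _ (h01 a i)

/-- For a density matrix of rank at most `R` the flatness deficit `‖ρ - π/R‖₁` is at most `2`, and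
by Cauchy-Schwarz on the support its square is at most `R tr ρ² - 1`. -/
theorem traceNorm_sub_smul_supportProj_bounds {A : Matrix ι ι ℂ} (hA : A.PosSemidef)
    (htr : A.trace = 1) {R : ℕ} (hR : A.rank ≤ R) :
    traceNorm (A - (((R : ℝ)⁻¹ : ℝ) : ℂ) • supportProj A) ≤ 2 ∧
      traceNorm (A - (((R : ℝ)⁻¹ : ℝ) : ℂ) • supportProj A) ^ 2 ≤ R * (A * A).trace.re - 1 := by
  have hH := hA.isHermitian
  set l := hH.eigenvalues with hl
  have hl0 : ∀ i, 0 ≤ l i := hA.eigenvalues_nonneg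
  have h1 : ∑ i, l i = 1 := by
    have := trace_pow_eq_sum_eigenvalues hH 1
    rw [pow_one, htr] at this
    simp only [pow_one] at this
    exact_mod_cast this.symm
  have h2 : (A * A).trace.re = ∑ i, l i ^ 2 := by
    rw [← pow_two, trace_pow_eq_sum_eigenvalues hH, Complex.ofReal_re]
  set s := Finset.univ.filter fun i => l i ≠ 0 with hs
  have hcard : (s.card : ℝ) ≤ R := by
    rw [hH.rank_eq_card_non_zero_eigs, Fintype.card_subtype] at hR
    exact_mod_cast hR
  have hsne : s.Nonempty := by
    by_contra h
    rw [Finset.not_nonempty_iff_eq_empty] at h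
    have : ∑ i, l i = 0 := Finset.sum_eq_zero fun i _ => by
      by_contra hi
      have : i ∈ s := by simp [hs, hi]
      simp [h] at this
    linarith
  have hRpos : (0 : ℝ) < R := lt_of_lt_of_le (by exact_mod_cast hsne.card_pos) hcard
  have hs1 : ∑ i ∈ s, l i = 1 := by
    rw [← h1, hs]; exact Finset.sum_filter_ne_zero _
  have hs2 : ∑ i ∈ s, l i ^ 2 = ∑ i, l i ^ 2 := by
    refine Finset.sum_subset (Finset.subset_univ _) fun i _ hi => ?_
    have : l i = 0 := by simpa [hs] using hi
    simp [this]
  have hX : traceNorm (A - (((R : ℝ)⁻¹ : ℝ) : ℂ) • supportProj A) = ∑ i ∈ s, |l i - (R : ℝ)⁻¹| := by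
    rw [traceNorm_sub_smul_supportProj hH]
    symm
    rw [← Finset.sum_subset (Finset.subset_univ s)]
    · refine Finset.sum_congr rfl fun i hi => ?_
      have : l i ≠ 0 := by simpa [hs] using hi
      simp [← hl, this]
    · intro i _ hi
      have : l i = 0 := by simpa [hs] using hi
      simp [← hl, this]
  rw [hX, h2]
  constructor
  · calc ∑ i ∈ s, |l i - (R : ℝ)⁻¹| ≤ ∑ i ∈ s, (l i + (R : ℝ)⁻¹) := by
          refine Finset.sum_le_sum fun i _ => ?_
          have := inv_pos.mpr hRpos
          rw [abs_le]; constructor <;> linarith [hl0 i]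
      _ = 1 + s.card * (R : ℝ)⁻¹ := by rw [Finset.sum_add_distrib, hs1]; simp
      _ ≤ 1 + 1 := by
          gcongr
          rw [← div_eq_mul_inv, div_le_one hRpos]; exact hcard
      _ = 2 := by norm_num
  · -- The cross term `-2 / R` outweighs the term `#s / R² ≤ 1 / R` after multiplication by `R`.
    have hcs := sq_sum_le_card_mul_sum_sq (s := s) (f := fun i => |l i - (R : ℝ)⁻¹|)
    have hexp : ∑ i ∈ s, |l i - (R : ℝ)⁻¹| ^ 2 =
        ∑ i, l i ^ 2 - 2 * (R : ℝ)⁻¹ + s.card * (R : ℝ)⁻¹ ^ 2 := by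
      simp_rw [sq_abs, sub_sq]
      rw [Finset.sum_add_distrib, Finset.sum_sub_distrib, hs2, ← Finset.sum_mul, ← Finset.mul_sum,
        hs1]
      simp
    refine hcs.trans ?_
    calc (s.card : ℝ) * ∑ i ∈ s, |l i - (R : ℝ)⁻¹| ^ 2
        ≤ R * ∑ i ∈ s, |l i - (R : ℝ)⁻¹| ^ 2 := by gcongr
      _ = R * ∑ i, l i ^ 2 - 2 + s.card * (R : ℝ)⁻¹ := by
          rw [hexp]; field_simp
      _ ≤ R * ∑ i, l i ^ 2 - 1 := by
          have : s.card * (R : ℝ)⁻¹ ≤ 1 := by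
            rw [← div_eq_mul_inv, div_le_one hRpos]; exact hcard
          linarith

end Spectral

/-! ### Moments of Haar random vectors -/

section HaarMoments

variable {ι : Type*} [Fintype ι] [DecidableEq ι]

theorem continuous_unitary_mulVec (x : ι → ℂ) :
    Continuous fun U : Matrix.unitaryGroup ι ℂ => (U : Matrix ι ι ℂ) *ᵥ x :=
  Continuous.matrix_mulVec continuous_subtype_val continuous_const

instance isProbabilityMeasure_haarMeasure_unitaryGroup :
    IsProbabilityMeasure (Measure.haarMeasure
      (⊤ : TopologicalSpace.PositiveCompacts (Matrix.unitaryGroup ι ℂ))) :=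
  ⟨Measure.haarMeasure_self⟩

theorem diagonal_update_mem_unitaryGroup (i₀ : ι) {z : ℂ} (hz : z * star z = 1) :
    Matrix.diagonal (Function.update (fun _ : ι => (1 : ℂ)) i₀ z) ∈ Matrix.unitaryGroup ι ℂ := by
  rw [Matrix.mem_unitaryGroup_iff, Matrix.star_eq_conjTranspose, Matrix.diagonal_conjTranspose,
    Matrix.diagonal_mul_diagonal, ← Matrix.diagonal_one]
  congr 1
  ext j
  by_cases h : j = i₀
  · subst h; simpa using hz
  · simp [h]

/-- A reflection of the plane spanned by the coordinates `i` and `k` with rational entries `±3/5`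
and `±4/5`, the Householder reflection along `e_i + 2 e_k`. -/
def planeReflection (i k : ι) : Matrix ι ι ℂ :=
  1 - (2 / 5 : ℂ) • Matrix.vecMulVec (Pi.single i 1 + Pi.single k 2) (Pi.single i 1 + Pi.single k 2)

theorem planeReflection_mem_unitaryGroup {i k : ι} (h : i ≠ k) :
    planeReflection i k ∈ Matrix.unitaryGroup ι ℂ := by
  set u : ι → ℂ := Pi.single i 1 + Pi.single k 2 with hu
  have hsu : star u = u := by
    ext j; simp only [hu, Pi.star_apply, Pi.add_apply, Pi.single_apply]; split_ifs <;> simp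
  have hstar : star (planeReflection i k) = planeReflection i k := by
    simp [planeReflection, ← hu, Matrix.star_eq_conjTranspose, Matrix.conjTranspose_vecMulVec, hsu]
  have huu : u ⬝ᵥ u = 5 := by
    simp [hu, h, h.symm]; norm_num
  rw [Matrix.mem_unitaryGroup_iff, hstar]
  simp only [planeReflection, ← hu]
  rw [sub_mul, one_mul, mul_sub, mul_one, Matrix.smul_mul, Matrix.mul_smul,
    Matrix.vecMulVec_mul_vecMulVec, huu, Matrix.vecMulVec_smul, smul_smul, smul_smul]
  rw [show (2 / 5 * (2 / 5) * 5 : ℂ) = 2 / 5 + 2 / 5 by norm_num, add_smul]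
  abel

theorem planeReflection_mulVec_left {i k : ι} (h : i ≠ k) (v : ι → ℂ) :
    (planeReflection i k *ᵥ v) i = 3 / 5 * v i - 4 / 5 * v k := by
  simp [planeReflection, Matrix.sub_mulVec, Matrix.smul_mulVec, Matrix.vecMulVec_mulVec, h]
  ring

variable [Nonempty ι]

instance isProbabilityMeasure_haarVector : IsProbabilityMeasure (haarVector ι) :=
  Measure.isProbabilityMeasure_map (continuous_unitary_mulVec _).measurable.aemeasurable

theorem integral_haarVector {f : (ι → ℂ) → ℂ} (hf : Continuous f) :
    ∫ v, f v ∂haarVector ι = ∫ U : Matrix.unitaryGroup ι ℂ,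
      f ((U : Matrix ι ι ℂ) *ᵥ Pi.single (Classical.arbitrary ι) 1)
      ∂Measure.haarMeasure (⊤ : TopologicalSpace.PositiveCompacts (Matrix.unitaryGroup ι ℂ)) :=
  integral_map (continuous_unitary_mulVec _).measurable.aemeasurable
    hf.measurable.aestronglyMeasurable

theorem integrable_haarVector {f : (ι → ℂ) → ℂ} (hf : Continuous f) :
    Integrable f (haarVector ι) := by
  rw [haarVector, integrable_map_measure hf.measurable.aestronglyMeasurable
    (continuous_unitary_mulVec _).measurable.aemeasurable]
  exact (hf.comp (continuous_unitary_mulVec _)).integrable_of_hasCompactSupport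
    (HasCompactSupport.of_compactSpace _)

theorem integral_haarVector_mulVec {W : Matrix ι ι ℂ} (hW : W ∈ Matrix.unitaryGroup ι ℂ)
    {f : (ι → ℂ) → ℂ} (hf : Continuous f) :
    ∫ v, f (W *ᵥ v) ∂haarVector ι = ∫ v, f v ∂haarVector ι := by
  rw [integral_haarVector (f := fun v => f (W *ᵥ v)) (by fun_prop), integral_haarVector hf]
  simp_rw [Matrix.mulVec_mulVec]
  exact integral_mul_left_eq_self (fun U : Matrix.unitaryGroup ι ℂ =>
    f ((U : Matrix ι ι ℂ) *ᵥ Pi.single (Classical.arbitrary ι) 1)) ⟨W, hW⟩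

/-- The law is carried by the unit sphere: `∑ |v_i|²` may be inserted under the integral. -/
theorem integral_haarVector_mul_sum {f : (ι → ℂ) → ℂ} (hf : Continuous f) :
    ∫ v, f v * ∑ i, v i * star (v i) ∂haarVector ι = ∫ v, f v ∂haarVector ι := by
  rw [integral_haarVector (f := fun v => f v * ∑ i, v i * star (v i)) (by fun_prop),
    integral_haarVector hf]
  congr 1
  ext U
  have h : star (U : Matrix ι ι ℂ) * (U : Matrix ι ι ℂ) = 1 :=
    (Matrix.mem_unitaryGroup_iff').mp U.2
  have := congrFun (congrFun h (Classical.arbitrary ι)) (Classical.arbitrary ι)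
  rw [Matrix.mul_apply] at this
  simp only [Matrix.star_apply, Matrix.one_apply_eq] at this
  have hcol : (U : Matrix ι ι ℂ) *ᵥ Pi.single (Classical.arbitrary ι) 1 =
      fun i => (U : Matrix ι ι ℂ) i (Classical.arbitrary ι) := by
    rw [Matrix.mulVec_single_one]; rfl
  simp_rw [hcol, mul_comm _ (star _)]
  rw [this, mul_one]

/-- A balanced monomial whose degrees in `v i₀` and in its conjugate differ integrates to zero:
rotate the phase of the coordinate `i₀` by `√-1`. -/
theorem integral_haarVector_four_eq_zero {i k j l : ι} (i₀ : ι)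
    (h : (if i = i₀ then 1 else 0) + (if k = i₀ then 1 else 0) ≠
      ((if j = i₀ then 1 else 0) + (if l = i₀ then 1 else 0) : ℕ)) :
    ∫ v, v i * v k * star (v j) * star (v l) ∂haarVector ι = 0 := by
  have hinv := integral_haarVector_mulVec (diagonal_update_mem_unitaryGroup i₀
    (z := Complex.I) (by simp)) (f := fun v : ι → ℂ => v i * v k * star (v j) * star (v l))
    (by fun_prop)
  simp only [Matrix.mulVec_diagonal, Function.update_apply] at hinv
  set z : ι → ℂ := fun a => if a = i₀ then Complex.I else 1 with hz
  have hz' : ∫ v, z i * z k * star (z j) * star (z l) *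
      (v i * v k * star (v j) * star (v l)) ∂haarVector ι =
      ∫ v, v i * v k * star (v j) * star (v l) ∂haarVector ι := by
    rw [← hinv]
    congr 1
    ext v
    simp only [hz, star_mul']
    ring
  rw [integral_const_mul] at hz'
  have hne : z i * z k * star (z j) * star (z l) ≠ 1 := by
    simp only [hz]
    -- The phase is `I ^ k` with `0 < |k| ≤ 2`.
    revert h
    have e1 : (-1 : ℂ) ≠ 1 := by norm_num
    have e2 : Complex.I ≠ 1 := by simp [Complex.ext_iff]
    have e3 : -Complex.I ≠ 1 := by simp [Complex.ext_iff]
    split_ifs <;> simp [e1, e2, e3]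
  by_contra h0
  exact hne (mul_right_cancel₀ h0 (hz'.trans (one_mul _).symm))

/-- The first moment of a Haar random unit vector: `E |v⟩⟨v|` is the identity divided by `d`. Sign
flips kill the off-diagonal entries and a rotation of two coordinates makes the diagonal ones equal. -/
theorem integral_haarVector_two (i j : ι) :
    ∫ v, v i * star (v j) ∂haarVector ι = if i = j then ((Fintype.card ι : ℕ) : ℂ)⁻¹ else 0 := by
  have hoff : ∀ i j : ι, i ≠ j → ∫ v, v i * star (v j) ∂haarVector ι = 0 := by
    intro i j hij
    have hinv := integral_haarVector_mulVec (diagonal_update_mem_unitaryGroup i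
      (z := -1) (by simp)) (f := fun v : ι → ℂ => v i * star (v j)) (by fun_prop)
    simp only [Matrix.mulVec_diagonal, Function.update_apply, hij.symm, if_true, if_false,
      neg_mul, one_mul, integral_neg] at hinv
    exact self_eq_neg.mp hinv.symm
  split_ifs with h
  swap
  · exact hoff i j h
  subst h
  have hint : ∀ i j : ι, Integrable (fun v : ι → ℂ => v i * star (v j)) (haarVector ι) :=
    fun i j => integrable_haarVector (by fun_prop)
  have heq : ∀ k, ∫ v, v k * star (v k) ∂haarVector ι = ∫ v, v i * star (v i) ∂haarVector ι := by
    intro k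
    by_cases hik : i = k
    · rw [hik]
    have hinv := integral_haarVector_mulVec (planeReflection_mem_unitaryGroup hik)
      (f := fun v : ι → ℂ => v i * star (v i)) (by fun_prop)
    simp only [planeReflection_mulVec_left hik] at hinv
    have hexp : ∀ v : ι → ℂ, (3 / 5 * v i - 4 / 5 * v k) * star (3 / 5 * v i - 4 / 5 * v k) =
        9 / 25 * (v i * star (v i)) + 16 / 25 * (v k * star (v k)) +
        (-12 / 25) * (v i * star (v k)) + (-12 / 25) * (v k * star (v i)) := by
      intro v
      simp only [star_sub, star_mul', star_div₀, star_ofNat]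
      ring
    simp_rw [hexp] at hinv
    rw [integral_add, integral_add, integral_add] at hinv
    · simp only [integral_const_mul, hoff i k hik, hoff k i (Ne.symm hik)] at hinv
      linear_combination (25 / 16) * hinv
    all_goals
      first
      | exact (hint _ _).const_mul _
      | exact integrable_haarVector (by fun_prop)
  have hsum := integral_haarVector_mul_sum (ι := ι) (f := fun _ => 1) continuous_const
  simp only [one_mul] at hsum
  rw [integral_finsetSum _ fun i _ => hint i i] at hsum
  simp only [heq, integral_const, Finset.sum_const, Finset.card_univ, nsmul_eq_mul,
    probReal_univ, one_smul] at hsum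
  exact eq_inv_of_mul_eq_one_right hsum

/-- The second moment of a Haar random unit vector: `E |v⟩⟨v|^{⊗2}` is the identity plus the swap,
divided by `d (d + 1)`. Invariance under phases leaves `E |v_i|⁴` and `E |v_i|² |v_k|²`, invariance
under `planeReflection` gives `E |v_i|⁴ = 2 E |v_i|² |v_k|²`, and `∑ |v_k|² = 1` fixes the value. -/
theorem integral_haarVector_four (i k j l : ι) :
    ∫ v, v i * v k * star (v j) * star (v l) ∂haarVector ι =
      (((Fintype.card ι : ℕ) : ℂ) * ((Fintype.card ι : ℕ) + 1))⁻¹ *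
        ((if i = l ∧ k = j then 1 else 0) + (if i = j ∧ k = l then 1 else 0)) := by
  set E : ι → ι → ι → ι → ℂ := fun i k j l =>
    ∫ v, v i * v k * star (v j) * star (v l) ∂haarVector ι with hE
  have hint : ∀ i k j l : ι, Integrable (fun v : ι → ℂ => v i * v k * star (v j) * star (v l))
      (haarVector ι) := fun i k j l => integrable_haarVector (by fun_prop)
  have hrot : ∀ i k, i ≠ k → E i i i i =
      81 / 625 * E i i i i + 256 / 625 * E k k k k + 576 / 625 * E i k i k := by
    intro i k hik
    have hki := Ne.symm hik
    have hinv := integral_haarVector_mulVec (planeReflection_mem_unitaryGroup hik)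
      (f := fun v : ι → ℂ => v i * v i * star (v i) * star (v i)) (by fun_prop)
    simp only [planeReflection_mulVec_left hik] at hinv
    have hexp : ∀ v : ι → ℂ, (3 / 5 * v i - 4 / 5 * v k) * (3 / 5 * v i - 4 / 5 * v k) *
        star (3 / 5 * v i - 4 / 5 * v k) * star (3 / 5 * v i - 4 / 5 * v k) =
        81 / 625 * (v i * v i * star (v i) * star (v i)) +
        256 / 625 * (v k * v k * star (v k) * star (v k)) +
        576 / 625 * (v i * v k * star (v i) * star (v k)) +
        (-216 / 625) * (v i * v i * star (v i) * star (v k)) +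
        (-216 / 625) * (v i * v k * star (v i) * star (v i)) +
        (-384 / 625) * (v k * v k * star (v i) * star (v k)) +
        (-384 / 625) * (v i * v k * star (v k) * star (v k)) +
        144 / 625 * (v i * v i * star (v k) * star (v k)) +
        144 / 625 * (v k * v k * star (v i) * star (v i)) := by
      intro v
      simp only [star_sub, star_mul', star_div₀, star_ofNat]
      ring
    simp_rw [hexp] at hinv
    rw [integral_add, integral_add, integral_add, integral_add, integral_add, integral_add,
      integral_add, integral_add] at hinv
    · simp only [integral_const_mul] at hinv
      rw [integral_haarVector_four_eq_zero (i := i) (k := i) (j := i) (l := k) k (by simp [hik]),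
        integral_haarVector_four_eq_zero (i := i) (k := k) (j := i) (l := i) k (by simp [hik]),
        integral_haarVector_four_eq_zero (i := k) (k := k) (j := i) (l := k) i (by simp [hki]),
        integral_haarVector_four_eq_zero (i := i) (k := k) (j := k) (l := k) i (by simp [hki]),
        integral_haarVector_four_eq_zero (i := i) (k := i) (j := k) (l := k) i (by simp [hki]),
        integral_haarVector_four_eq_zero (i := k) (k := k) (j := i) (l := i) i (by simp [hki])]
        at hinv
      simp only [hE]
      linear_combination -hinv
    all_goals
      first
      | exact (hint _ _ _ _).const_mul _
      | exact integrable_haarVector (by fun_prop)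
  have hsymm : ∀ i k, E i k i k = E k i k i := by
    intro i k
    simp only [hE]
    congr 1
    ext v
    ring
  have hdiag : ∀ i k, E i i i i = E k k k k := by
    intro i k
    by_cases h : i = k
    · rw [h]
    have h1 := hrot i k h
    have h2 := hrot k i (Ne.symm h)
    rw [hsymm k i] at h2
    linear_combination (625 / 800) * (h1 - h2)
  have hhalf : ∀ i k, i ≠ k → E i i i i = 2 * E i k i k := by
    intro i k h
    have h1 := hrot i k h
    rw [hdiag k i] at h1
    linear_combination (625 / 288) * h1
  have hsum : ∀ i, ((Fintype.card ι : ℕ) : ℂ)⁻¹ = ∑ k, E i k i k := by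
    intro i
    have h1 := integral_haarVector_mul_sum (ι := ι) (f := fun v => v i * star (v i)) (by fun_prop)
    rw [integral_haarVector_two, if_pos rfl] at h1
    rw [← h1, ← integral_finsetSum _ fun k _ => hint i k i k]
    congr 1
    ext v
    rw [Finset.mul_sum]
    exact Finset.sum_congr rfl fun k _ => by ring
  have hd : ((Fintype.card ι : ℕ) : ℂ) ≠ 0 := Nat.cast_ne_zero.mpr Fintype.card_ne_zero
  have hd1 : ((Fintype.card ι : ℕ) : ℂ) + 1 ≠ 0 := Nat.cast_add_one_ne_zero _
  have hval : ∀ i, E i i i i =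
      2 * (((Fintype.card ι : ℕ) : ℂ) * ((Fintype.card ι : ℕ) + 1))⁻¹ := by
    intro i
    have h1 := hsum i
    have h2 : ∀ k, 2 * E i k i k = E i i i i + if k = i then E i i i i else 0 := by
      intro k
      split_ifs with h
      · rw [h]; ring
      · rw [hhalf i k (Ne.symm h), add_zero]
    have h3 : 2 * ((Fintype.card ι : ℕ) : ℂ)⁻¹ = (Fintype.card ι : ℕ) * E i i i i + E i i i i := by
      rw [h1, Finset.mul_sum]
      simp_rw [h2]
      rw [Finset.sum_add_distrib]
      simp
    field_simp at h3 ⊢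
    linear_combination -h3
  have hoffval : ∀ i k, i ≠ k → E i k i k =
      (((Fintype.card ι : ℕ) : ℂ) * ((Fintype.card ι : ℕ) + 1))⁻¹ := by
    intro i k h
    linear_combination (-1 / 2) * hhalf i k h + (1 / 2) * hval i
  change E i k j l = _
  have hzero : ∀ i₀ : ι, ((if i = i₀ then 1 else 0) + (if k = i₀ then 1 else 0) ≠
      ((if j = i₀ then 1 else 0) + (if l = i₀ then 1 else 0) : ℕ)) → E i k j l = 0 :=
    fun i₀ => integral_haarVector_four_eq_zero i₀
  by_cases hij : i = j
  · subst hij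
    by_cases hkl : k = l
    · subst hkl
      by_cases hik : i = k
      · subst hik
        rw [hval]; simp; ring
      · rw [hoffval i k hik]; simp [hik]
    · rw [hzero k (by simp [Ne.symm hkl])]
      have : ¬ (i = l ∧ k = i) := fun h => hkl (h.2.trans h.1)
      simp [hkl, this]
  · by_cases hil : i = l
    · subst hil
      by_cases hkj : k = j
      · subst hkj
        have : E i k k i = E i k i k := by
          simp only [hE]; congr 1; ext v; ring
        rw [this, hoffval i k hij]; simp [hij]
      · rw [hzero k (by simp [Ne.symm hkj])]
        simp [hij, hkj]
    · rw [hzero i (by simp [Ne.symm hij, Ne.symm hil])]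
      simp [hij, hil]

end HaarMoments

/-! ### Swaps of two copies of a network of entangled pairs -/

section Swap

/-- The family that agrees with `x` where `p` holds and with `y` elsewhere. -/
def mix {κ : Type*} {β : κ → Type*} (p : κ → Prop) [DecidablePred p] (x y : ∀ i, β i) : ∀ i, β i :=
  fun i => if p i then x i else y i

theorem sum_mul_four {α β γ δ : Type*} [Fintype α] [Fintype β] [Fintype γ] [Fintype δ]
    (f : α → ℂ) (g : β → ℂ) (h : γ → ℂ) (k : δ → ℂ) :
    (∑ a, f a) * (∑ b, g b) * (∑ c, h c) * (∑ d, k d) =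
      ∑ a, ∑ b, ∑ c, ∑ d, f a * g b * h c * k d := by
  rw [Finset.sum_mul_sum]
  simp only [Finset.sum_mul]
  refine Finset.sum_congr rfl fun a _ => Finset.sum_congr rfl fun b _ => ?_
  rw [Finset.mul_sum _ h, Finset.sum_mul_sum]

variable {V : Type*} [Fintype V] [DecidableEq V] {G : SimpleGraph V} [DecidableRel G.Adj]
  (D : G.edgeSet → ℕ+) (Ψ : (e : G.edgeSet) → EIdx D e → ℂ)

/-- The coefficient of `⨂_e |Ψ_e⟩` at an assignment of labels to all half-edges. -/
def bondAmplitude (x : (v : V) → VIdx D v) : ℂ :=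
  ∏ e : G.edgeSet, Ψ e fun v => x v.1 ⟨e, v.2⟩

/-- Half-edges can be grouped by vertices or by edges. -/
def halfEdgeEquiv : ((v : V) → VIdx D v) ≃ ((e : G.edgeSet) → EIdx D e) where
  toFun x e v := x v.1 ⟨e, v.2⟩
  invFun y v e := y e.1 ⟨v, e.2⟩
  left_inv _ := rfl
  right_inv _ := rfl

omit [DecidableEq V] in
theorem bondAmplitude_eq (x : (v : V) → VIdx D v) :
    bondAmplitude D Ψ x = ∏ e, Ψ e (halfEdgeEquiv D x e) := rfl

omit [Fintype V] [DecidableEq V] [DecidableRel G.Adj] in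
theorem halfEdgeEquiv_mix (p : V → Prop) [DecidablePred p] (x y : (v : V) → VIdx D v)
    (e : G.edgeSet) : halfEdgeEquiv D (mix p x y) e =
      mix (fun v => p v.1) (halfEdgeEquiv D x e) (halfEdgeEquiv D y e) := by
  funext v
  simp only [halfEdgeEquiv, mix, Equiv.coe_fn_mk]
  split_ifs <;> rfl

omit [Fintype V] [DecidableEq V] [DecidableRel G.Adj] in
theorem exists_other_vertex (e : G.edgeSet) (x : {v : V // v ∈ (e : Sym2 V)}) :
    ∃ x' : {v : V // v ∈ (e : Sym2 V)}, x' ≠ x ∧ ∀ v, v = x ∨ v = x' := by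
  obtain ⟨x, hx⟩ := x
  obtain ⟨y, hy⟩ := Sym2.mem_iff_exists.mp hx
  have hadj : G.Adj x y := by
    have := e.2
    rwa [hy, SimpleGraph.mem_edgeSet] at this
  refine ⟨⟨y, by rw [hy]; exact Sym2.mem_mk_right x y⟩,
    fun h => hadj.ne (congrArg Subtype.val h).symm, ?_⟩
  rintro ⟨v, hv⟩
  rw [hy, Sym2.mem_iff] at hv
  simpa using hv

variable {D}

omit [DecidableRel G.Adj] in
theorem sum_EIdx {e : G.edgeSet} {x x' : {v : V // v ∈ (e : Sym2 V)}} (hne : x' ≠ x)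
    (hall : ∀ v, v = x ∨ v = x') (f : EIdx D e → ℂ) :
    ∑ i, f i = ∑ p : Fin (D e : ℕ), ∑ q : Fin (D e : ℕ), f fun v => if v = x then p else q := by
  rw [← Fintype.sum_prod_type' (f := fun p q => f fun v => if v = x then p else q)]
  let E : EIdx D e ≃ Fin (D e : ℕ) × Fin (D e : ℕ) :=
    { toFun := fun i => (i x, i x')
      invFun := fun p v => if v = x then p.1 else p.2
      left_inv := fun i => by
        funext v
        rcases hall v with h | h
        · simp [h]
        · simp [h, hne]
      right_inv := fun p => by simp [hne] }
  exact Fintype.sum_equiv E _ _ fun i => congrArg f (E.left_inv i).symm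

omit [DecidableRel G.Adj] in
theorem IsMaxEntangled.sum_mul_star {e : G.edgeSet} {ψ : EIdx D e → ℂ} (h : IsMaxEntangled D e ψ) :
    ∑ i, ψ i * star (ψ i) = 1 := by
  obtain ⟨x, hx⟩ : ∃ x : V, x ∈ (e : Sym2 V) := ⟨_, Sym2.out_fst_mem _⟩
  obtain ⟨x', hne, hall⟩ := exists_other_vertex e ⟨x, hx⟩
  rw [sum_EIdx hne hall]
  simp_rw [h ⟨x, hx⟩]
  simp

/-- Swapping the two copies of a maximally entangled pair at both ends or at no end of the edge has
expectation `1`; swapping them at one end only gives the purity `1 / χ(e)` of the reduced state. -/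
theorem IsMaxEntangled.sum_swap {e : G.edgeSet} {ψ : EIdx D e → ℂ} (h : IsMaxEntangled D e ψ)
    (s : Finset V) :
    ∑ i, ∑ i', ψ i * ψ i' * star (ψ (mix (fun v => v.1 ∈ s) i' i)) *
        star (ψ (mix (fun v => v.1 ∈ s) i i')) =
      if e ∈ cutSurface G s then ((D e : ℕ) : ℂ)⁻¹ else 1 := by
  have hprod : ∑ i, ∑ i', (ψ i * star (ψ i)) * (ψ i' * star (ψ i')) = 1 := by
    simp_rw [← Finset.mul_sum, ← Finset.sum_mul, h.sum_mul_star, one_mul]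
  split_ifs with hcut
  · simp only [cutSurface, Finset.mem_filter, Finset.mem_univ, true_and] at hcut
    obtain ⟨⟨x, hxs, hx⟩, y, hys, hy⟩ := hcut
    rw [Finset.mem_compl] at hys
    obtain ⟨x', hne, hall⟩ := exists_other_vertex e ⟨x, hx⟩
    have hx' : x'.1 ∉ s := by
      rcases hall ⟨y, hy⟩ with h' | h'
      · have hyx : y = x := congrArg Subtype.val h'
        exact absurd (hyx ▸ hxs) hys
      · rw [← h']; exact hys
    have hmix : ∀ p q p' q' : Fin (D e : ℕ),
        (mix (fun v : {v : V // v ∈ (e : Sym2 V)} => v.1 ∈ s)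
          (fun v => if v = ⟨x, hx⟩ then p else q) (fun v => if v = ⟨x, hx⟩ then p' else q') :
            EIdx D e) = fun v => if v = ⟨x, hx⟩ then p else q' := by
      intro p q p' q'
      funext v
      rcases hall v with rfl | rfl
      · simp [mix, hxs]
      · simp [mix, hx', hne]
    rw [sum_EIdx hne hall]
    simp_rw [sum_EIdx hne hall (fun i' => _ * ψ i' * _ * _), hmix]
    have hx1 := h ⟨x, hx⟩
    calc _ = ∑ p : Fin (D e : ℕ), ∑ p' : Fin (D e : ℕ),
          (∑ q : Fin (D e : ℕ), ψ (fun v => if v = ⟨x, hx⟩ then p else q) *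
            star (ψ fun v => if v = ⟨x, hx⟩ then p' else q)) *
          (∑ q : Fin (D e : ℕ), ψ (fun v => if v = ⟨x, hx⟩ then p' else q) *
            star (ψ fun v => if v = ⟨x, hx⟩ then p else q)) := by
          refine Finset.sum_congr rfl fun p _ => ?_
          rw [Finset.sum_comm]
          refine Finset.sum_congr rfl fun p' _ => ?_
          rw [Finset.sum_mul_sum]
          refine Finset.sum_congr rfl fun q _ => Finset.sum_congr rfl fun q' _ => ?_
          ring
      _ = _ := by
          simp_rw [hx1]
          have hD : ((D e : ℕ) : ℂ) ≠ 0 := Nat.cast_ne_zero.mpr (D e).ne_zero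
          simp only [eq_comm, mul_ite, ite_mul, zero_mul, mul_zero]
          simp
  · simp only [cutSurface, Finset.mem_filter, Finset.mem_univ, true_and, not_and, not_exists,
      Finset.mem_compl] at hcut
    by_cases hx : ∃ x ∈ s, x ∈ (e : Sym2 V)
    · have hin : ∀ v : {v : V // v ∈ (e : Sym2 V)}, v.1 ∈ s := fun v => by
        by_contra hv; exact hcut hx v.1 hv v.2
      have hmix : ∀ i i' : EIdx D e, mix (fun v : {v : V // v ∈ (e : Sym2 V)} => v.1 ∈ s) i i' = i :=
        fun i i' => by funext v; simp [mix, hin v]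
      simp_rw [hmix]
      rw [← hprod]
      exact Finset.sum_congr rfl fun i _ => Finset.sum_congr rfl fun i' _ => by ring
    · have hout : ∀ v : {v : V // v ∈ (e : Sym2 V)}, v.1 ∉ s := fun v hv => hx ⟨v.1, hv, v.2⟩
      have hmix : ∀ i i' : EIdx D e, mix (fun v : {v : V // v ∈ (e : Sym2 V)} => v.1 ∈ s) i i' = i' :=
        fun i i' => by funext v; simp [mix, hout v]
      simp_rw [hmix]
      rw [← hprod]
      exact Finset.sum_congr rfl fun i _ => Finset.sum_congr rfl fun i' _ => by ring

theorem sum_bondAmplitude_mul_star (hΨ : ∀ e, IsMaxEntangled D e (Ψ e)) :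
    ∑ x, bondAmplitude D Ψ x * star (bondAmplitude D Ψ x) = 1 := by
  have h : ∏ e : G.edgeSet, ∑ i, Ψ e i * star (Ψ e i) = 1 :=
    Finset.prod_eq_one fun e _ => (hΨ e).sum_mul_star
  rw [Finset.prod_univ_sum, Fintype.piFinset_univ] at h
  rw [← h]
  refine Fintype.sum_equiv (halfEdgeEquiv D) _ _ fun x => ?_
  rw [bondAmplitude_eq, star_prod, ← Finset.prod_mul_distrib]

/-- The expectation of the swap of the region `s` in two copies of `⨂_e |Ψ_e⟩` only sees the cut
surface of `s`. -/
theorem sum_swap_bondAmplitude (hΨ : ∀ e, IsMaxEntangled D e (Ψ e)) (s : Finset V) :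
    ∑ x, ∑ x', bondAmplitude D Ψ x * bondAmplitude D Ψ x' *
        star (bondAmplitude D Ψ (mix (· ∈ s) x' x)) * star (bondAmplitude D Ψ (mix (· ∈ s) x x')) =
      ∏ e ∈ cutSurface G s, ((D e : ℕ) : ℂ)⁻¹ := by
  have h : ∏ e : G.edgeSet, ∑ i, ∑ i', Ψ e i * Ψ e i' *
        star (Ψ e (mix (fun v => v.1 ∈ s) i' i)) * star (Ψ e (mix (fun v => v.1 ∈ s) i i')) =
      ∏ e ∈ cutSurface G s, ((D e : ℕ) : ℂ)⁻¹ := by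
    rw [Finset.prod_congr rfl fun e _ => (hΨ e).sum_swap s, Finset.prod_ite_mem,
      Finset.univ_inter]
  rw [Finset.prod_univ_sum, Fintype.piFinset_univ] at h
  rw [← h]
  refine Fintype.sum_equiv (halfEdgeEquiv D) _ _ fun x => ?_
  rw [Finset.prod_univ_sum, Fintype.piFinset_univ]
  refine Fintype.sum_equiv (halfEdgeEquiv D) _ _ fun x' => ?_
  simp_rw [bondAmplitude_eq, star_prod, ← Finset.prod_mul_distrib, halfEdgeEquiv_mix]

end Swap

/-! ### Splitting configurations into boundary and bulk, and averaging over the tensors -/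

section Moments

variable {V : Type*} [Fintype V] [DecidableEq V] {G : SimpleGraph V} [DecidableRel G.Adj]
  (D : G.edgeSet → ℕ+) (Ψ : (e : G.edgeSet) → EIdx D e → ℂ) (bd : Finset V)

/-- Labels at the boundary together with labels in the bulk. -/
def join (b : RIdx D bd) (t : (v : Bulk bd) → VIdx D v.1) : (v : V) → VIdx D v :=
  (Equiv.piEquivPiSubtypeProd (· ∈ bd) (fun v => VIdx D v)).symm (b, t)

variable {D bd} in
theorem sum_join (f : ((v : V) → VIdx D v) → ℂ) :
    ∑ b : RIdx D bd, ∑ t : (v : Bulk bd) → VIdx D v.1, f (join D bd b t) = ∑ x, f x := by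
  rw [← Fintype.sum_prod_type' (f := fun b t => f (join D bd b t))]
  exact Fintype.sum_equiv (Equiv.piEquivPiSubtypeProd (· ∈ bd) (fun v => VIdx D v)).symm _ _
    fun _ => rfl

omit [Fintype V] [DecidableRel G.Adj] in
theorem join_apply_boundary (b : RIdx D bd) (t : (v : Bulk bd) → VIdx D v.1) (v : bd) :
    join D bd b t v = b v := by
  simp [join, Equiv.piEquivPiSubtypeProd]

omit [Fintype V] [DecidableRel G.Adj] in
theorem join_apply_bulk (b : RIdx D bd) (t : (v : Bulk bd) → VIdx D v.1) (v : Bulk bd) :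
    join D bd b t v = t v := by
  simp [join, Equiv.piEquivPiSubtypeProd, v.2]

theorem unnormalizedState_eq (T : Tensors D bd) (b : RIdx D bd) :
    unnormalizedState D Ψ bd T b = ∑ t : (v : Bulk bd) → VIdx D v.1,
      (∏ v, star (T v (t v))) * bondAmplitude D Ψ (join D bd b t) := by
  have : unnormalizedState D Ψ bd T b = ∑ x : (v : V) → VIdx D v,
      if (∀ v : bd, x v = b v) then
      (∏ v : Bulk bd, star (T v (x v.1))) * bondAmplitude D Ψ x else 0 := rfl
  rw [this, ← sum_join (bd := bd)]
  simp_rw [join_apply_boundary, join_apply_bulk, ← funext_iff]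
  rw [Finset.sum_eq_single b]
  · simp
  · intro b' _ hb'
    simp [hb']
  · simp

omit [Fintype V] [DecidableRel G.Adj] in
theorem join_mix {S : Finset V} (hS : S ⊆ bd) (r : Finset (Bulk bd)) (b b' : RIdx D bd)
    (t t' : (v : Bulk bd) → VIdx D v.1) :
    join D bd (mix (fun v => v.1 ∈ S) b b') (mix (· ∈ r) t t') =
      mix (· ∈ S ∪ r.map (Function.Embedding.subtype _)) (join D bd b t) (join D bd b' t') := by
  funext v
  by_cases hv : v ∈ bd
  · have h1 : v ∈ S ∪ r.map (Function.Embedding.subtype _) ↔ v ∈ S := by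
      simp [hv]
    have := join_apply_boundary D bd
    simp only [mix, h1]
    rw [this _ _ ⟨v, hv⟩, this _ _ ⟨v, hv⟩, this _ _ ⟨v, hv⟩]
    rfl
  · have h1 : v ∈ S ∪ r.map (Function.Embedding.subtype _) ↔ (⟨v, hv⟩ : Bulk bd) ∈ r := by
      have : v ∉ S := fun h => hv (hS h)
      simp [hv, this]
    have := join_apply_bulk D bd
    simp only [mix, h1]
    rw [this _ _ ⟨v, hv⟩, this _ _ ⟨v, hv⟩, this _ _ ⟨v, hv⟩]
    rfl

instance isProbabilityMeasure_haarTensors : IsProbabilityMeasure (haarTensors D bd) := by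
  unfold haarTensors; infer_instance

variable {D bd}

theorem integrable_haarTensors_prod {f : (v : Bulk bd) → (VIdx D v.1 → ℂ) → ℂ}
    (hf : ∀ v, Continuous (f v)) :
    Integrable (fun T : Tensors D bd => ∏ v, f v (T v)) (haarTensors D bd) :=
  Integrable.fintype_prod_dep fun v => integrable_haarVector (hf v)

theorem integral_haarTensors_two (t u : (v : Bulk bd) → VIdx D v.1) :
    ∫ T : Tensors D bd, ∏ v, (T v (u v) * star (T v (t v))) ∂haarTensors D bd =
      (∏ v : Bulk bd, ((Fintype.card (VIdx D v.1) : ℕ) : ℂ)⁻¹) * if u = t then 1 else 0 := by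
  have h : ∫ T : Tensors D bd, ∏ v, (T v (u v) * star (T v (t v))) ∂haarTensors D bd = _ :=
    integral_fintype_prod_eq_prod (fun v (w : VIdx D v.1 → ℂ) => w (u v) * star (w (t v)))
  rw [h]
  simp_rw [integral_haarVector_two]
  have : ∀ v : Bulk bd, (if u v = t v then ((Fintype.card (VIdx D v.1) : ℕ) : ℂ)⁻¹ else 0) =
      ((Fintype.card (VIdx D v.1) : ℕ) : ℂ)⁻¹ * if u v = t v then 1 else 0 := fun v => by simp
  simp_rw [this, Finset.prod_mul_distrib]
  congr 1
  rw [Finset.prod_ite_zero]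
  simp [funext_iff]

/-- Expanding the product over the bulk vertices of identity plus swap gives a sum over the set `r` of
vertices at which the two copies are swapped. -/
theorem integral_haarTensors_four (t t' u u' : (v : Bulk bd) → VIdx D v.1) :
    ∫ T : Tensors D bd, ∏ v, (T v (u v) * T v (u' v) * star (T v (t v)) * star (T v (t' v)))
        ∂haarTensors D bd =
      (∏ v : Bulk bd, (((Fintype.card (VIdx D v.1) : ℕ) : ℂ) *
        ((Fintype.card (VIdx D v.1) : ℕ) + 1))⁻¹) *
        ∑ r : Finset (Bulk bd), if u = mix (· ∈ r) t' t ∧ u' = mix (· ∈ r) t t' then 1 else 0 := by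
  have h : ∫ T : Tensors D bd, ∏ v, (T v (u v) * T v (u' v) * star (T v (t v)) * star (T v (t' v)))
      ∂haarTensors D bd = _ :=
    integral_fintype_prod_eq_prod (fun v (w : VIdx D v.1 → ℂ) =>
      w (u v) * w (u' v) * star (w (t v)) * star (w (t' v)))
  rw [h]
  simp_rw [integral_haarVector_four, Finset.prod_mul_distrib]
  rw [Finset.prod_add, Finset.powerset_univ]
  congr 1
  refine Finset.sum_congr rfl fun r _ => ?_
  have hiff : ((∀ v ∈ r, u v = t' v ∧ u' v = t v) ∧
      ∀ v ∈ Finset.univ \ r, u v = t v ∧ u' v = t' v) ↔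
      u = mix (· ∈ r) t' t ∧ u' = mix (· ∈ r) t t' := by
    simp only [funext_iff, mix, Finset.mem_sdiff, Finset.mem_univ, true_and]
    constructor
    · rintro ⟨h1, h2⟩
      refine ⟨fun v => ?_, fun v => ?_⟩ <;> split_ifs with hv
      all_goals grind
    · rintro ⟨h1, h2⟩
      refine ⟨fun v hv => ?_, fun v hv => ?_⟩
      all_goals
        have := h1 v
        have := h2 v
        simp_all
  rw [Finset.prod_ite_zero, Finset.prod_ite_zero]
  simp only [Finset.prod_const_one]
  by_cases hC : u = mix (· ∈ r) t' t ∧ u' = mix (· ∈ r) t t'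
  · rw [if_pos (hiff.mpr hC).1, if_pos (hiff.mpr hC).2, if_pos hC, mul_one]
  · rw [if_neg hC]
    by_cases h1 : ∀ v ∈ r, u v = t' v ∧ u' v = t v
    · rw [if_neg fun h2 => hC (hiff.mp ⟨h1, h2⟩), mul_zero]
    · rw [if_neg h1, zero_mul]

end Moments

/-! ### Moments of the unnormalized tensor network state -/

section StateMoments

theorem sum_rotate {α β γ : Type*} [Fintype α] [Fintype β] [Fintype γ] (f : α → β → γ → ℂ) :
    ∑ a, ∑ b, ∑ c, f a b c = ∑ c, ∑ a, ∑ b, f a b c :=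
  (Finset.sum_congr rfl fun _ _ => Finset.sum_comm).trans Finset.sum_comm

variable {V : Type*} [Fintype V] [DecidableEq V] {G : SimpleGraph V} [DecidableRel G.Adj]
  {D : G.edgeSet → ℕ+} (Ψ : (e : G.edgeSet) → EIdx D e → ℂ) {bd : Finset V}

variable (D bd) in
/-- The product of `1 / dim ℋ^v` over the bulk vertices, the expected squared norm of the
unnormalized state. -/
def meanNorm : ℝ := ∏ v : Bulk bd, ((Fintype.card (VIdx D v.1) : ℕ) : ℝ)⁻¹

theorem integral_sum_unnormalizedState_mul_star (hΨ : ∀ e, IsMaxEntangled D e (Ψ e)) :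
    Integrable (fun T : Tensors D bd =>
      ∑ b, unnormalizedState D Ψ bd T b * star (unnormalizedState D Ψ bd T b)) (haarTensors D bd) ∧
    ∫ T : Tensors D bd, ∑ b, unnormalizedState D Ψ bd T b * star (unnormalizedState D Ψ bd T b)
      ∂haarTensors D bd = (meanNorm D bd : ℂ) := by
  have hexp : ∀ T : Tensors D bd,
      ∑ b, unnormalizedState D Ψ bd T b * star (unnormalizedState D Ψ bd T b) =
      ∑ b : RIdx D bd, ∑ t : (v : Bulk bd) → VIdx D v.1, ∑ u : (v : Bulk bd) → VIdx D v.1,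
        (∏ v, (T v (u v) * star (T v (t v)))) *
        (bondAmplitude D Ψ (join D bd b t) * star (bondAmplitude D Ψ (join D bd b u))) := by
    intro T
    refine Finset.sum_congr rfl fun b _ => ?_
    rw [unnormalizedState_eq, star_sum, Finset.sum_mul_sum]
    refine Finset.sum_congr rfl fun t _ => Finset.sum_congr rfl fun u _ => ?_
    rw [Finset.prod_mul_distrib, star_mul', star_prod]
    simp only [star_star]
    ring
  have hint : ∀ (b : RIdx D bd) (t u : (v : Bulk bd) → VIdx D v.1),
      Integrable (fun T : Tensors D bd => (∏ v, (T v (u v) * star (T v (t v)))) *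
        (bondAmplitude D Ψ (join D bd b t) * star (bondAmplitude D Ψ (join D bd b u))))
        (haarTensors D bd) := fun b t u => (integrable_haarTensors_prod
          (f := fun v w => w (u v) * star (w (t v))) fun v => by fun_prop).mul_const _
  simp_rw [hexp]
  refine ⟨integrable_finsetSum _ fun b _ => integrable_finsetSum _ fun t _ =>
    integrable_finsetSum _ fun u _ => hint b t u, ?_⟩
  rw [integral_finsetSum _ fun b _ => integrable_finsetSum _ fun t _ =>
    integrable_finsetSum _ fun u _ => hint b t u]
  have h1 : ∀ b : RIdx D bd, ∫ T : Tensors D bd, ∑ t, ∑ u, (∏ v, (T v (u v) * star (T v (t v)))) *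
        (bondAmplitude D Ψ (join D bd b t) * star (bondAmplitude D Ψ (join D bd b u)))
        ∂haarTensors D bd = (meanNorm D bd : ℂ) *
        ∑ t, bondAmplitude D Ψ (join D bd b t) * star (bondAmplitude D Ψ (join D bd b t)) := by
    intro b
    rw [integral_finsetSum _ fun t _ => integrable_finsetSum _ fun u _ => hint b t u,
      Finset.mul_sum]
    refine Finset.sum_congr rfl fun t _ => ?_
    rw [integral_finsetSum _ fun u _ => hint b t u]
    simp_rw [integral_mul_const, integral_haarTensors_two]
    simp [meanNorm]
  simp_rw [h1]
  rw [← Finset.mul_sum, sum_join (fun x => bondAmplitude D Ψ x * star (bondAmplitude D Ψ x)),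
    sum_bondAmplitude_mul_star Ψ hΨ, mul_one]

/-- The expectation of the swap of the boundary region `S` in two copies of the unnormalized state:
the squared norm to the power two for `S = ∅`, the purity of the reduced state for general `S`. -/
def swapMoment (S : Finset V) (T : Tensors D bd) : ℂ :=
  ∑ b : RIdx D bd, ∑ b' : RIdx D bd,
    unnormalizedState D Ψ bd T b * unnormalizedState D Ψ bd T b' *
      star (unnormalizedState D Ψ bd T (mix (fun v => v.1 ∈ S) b' b)) *
      star (unnormalizedState D Ψ bd T (mix (fun v => v.1 ∈ S) b b'))

/-- Averaging over the tensors turns the swap of a boundary region into a sum over its extensions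
into the bulk, the partition function of an Ising model with domain wall tension `log χ(e)`. -/
theorem integral_swapMoment (hΨ : ∀ e, IsMaxEntangled D e (Ψ e)) {S : Finset V} (hS : S ⊆ bd) :
    Integrable (swapMoment Ψ S) (haarTensors D bd) ∧
    ∫ T : Tensors D bd, swapMoment Ψ S T ∂haarTensors D bd =
      (∏ v : Bulk bd, (((Fintype.card (VIdx D v.1) : ℕ) : ℂ) *
        ((Fintype.card (VIdx D v.1) : ℕ) + 1))⁻¹) *
      ∑ r : Finset (Bulk bd),
        ∏ e ∈ cutSurface G (S ∪ r.map (Function.Embedding.subtype _)), ((D e : ℕ) : ℂ)⁻¹ := by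
  set Φ := bondAmplitude D Ψ with hΦ
  -- `t, t'` are the bulk labels in the two factors `ψ`, and `u, u'` those in the factors `star ψ`.
  set K : RIdx D bd → RIdx D bd → ((v : Bulk bd) → VIdx D v.1) → ((v : Bulk bd) → VIdx D v.1) →
    ((v : Bulk bd) → VIdx D v.1) → ((v : Bulk bd) → VIdx D v.1) → ℂ := fun b b' t t' u u' =>
      Φ (join D bd b t) * Φ (join D bd b' t') *
      star (Φ (join D bd (mix (fun v => v.1 ∈ S) b' b) u)) *
      star (Φ (join D bd (mix (fun v => v.1 ∈ S) b b') u')) with hK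
  have hexp : (swapMoment Ψ S : Tensors D bd → ℂ) = fun T =>
      ∑ b : RIdx D bd, ∑ b' : RIdx D bd, ∑ t : (v : Bulk bd) → VIdx D v.1,
        ∑ t' : (v : Bulk bd) → VIdx D v.1,
        ∑ u : (v : Bulk bd) → VIdx D v.1, ∑ u' : (v : Bulk bd) → VIdx D v.1,
        (∏ v, (T v (u v) * T v (u' v) * star (T v (t v)) * star (T v (t' v)))) *
        K b b' t t' u u' := by
    funext T
    refine Finset.sum_congr rfl fun b _ => Finset.sum_congr rfl fun b' _ => ?_
    simp_rw [unnormalizedState_eq, star_sum]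
    rw [sum_mul_four]
    refine Finset.sum_congr rfl fun t _ => Finset.sum_congr rfl fun t' _ =>
      Finset.sum_congr rfl fun u _ => Finset.sum_congr rfl fun u' _ => ?_
    simp only [Finset.prod_mul_distrib, star_mul', star_prod, star_star, hK, hΦ]
    ring
  have hint : ∀ (b b' : RIdx D bd) (t t' u u' : (v : Bulk bd) → VIdx D v.1),
      Integrable (fun T : Tensors D bd =>
        (∏ v, (T v (u v) * T v (u' v) * star (T v (t v)) * star (T v (t' v)))) *
        K b b' t t' u u') (haarTensors D bd) := fun b b' t t' u u' => (integrable_haarTensors_prod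
          (f := fun v w => w (u v) * w (u' v) * star (w (t v)) * star (w (t' v)))
          fun v => by fun_prop).mul_const _
  have hint2 : ∀ (b b' : RIdx D bd) (t t' : (v : Bulk bd) → VIdx D v.1),
      Integrable (fun T : Tensors D bd => ∑ u : (v : Bulk bd) → VIdx D v.1,
        ∑ u' : (v : Bulk bd) → VIdx D v.1,
        (∏ v, (T v (u v) * T v (u' v) * star (T v (t v)) * star (T v (t' v)))) *
        K b b' t t' u u') (haarTensors D bd) := fun b b' t t' =>
    integrable_finsetSum _ fun u _ => integrable_finsetSum _ fun u' _ => hint b b' t t' u u'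
  have hint4 : ∀ (b b' : RIdx D bd),
      Integrable (fun T : Tensors D bd => ∑ t : (v : Bulk bd) → VIdx D v.1,
        ∑ t' : (v : Bulk bd) → VIdx D v.1, ∑ u : (v : Bulk bd) → VIdx D v.1,
        ∑ u' : (v : Bulk bd) → VIdx D v.1,
        (∏ v, (T v (u v) * T v (u' v) * star (T v (t v)) * star (T v (t' v)))) *
        K b b' t t' u u') (haarTensors D bd) := fun b b' =>
    integrable_finsetSum _ fun t _ => integrable_finsetSum _ fun t' _ => hint2 b b' t t'
  rw [hexp]
  refine ⟨integrable_finsetSum _ fun b _ => integrable_finsetSum _ fun b' _ => hint4 b b', ?_⟩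
  rw [integral_finsetSum _ fun b _ => integrable_finsetSum _ fun b' _ => hint4 b b']
  set c : ℂ := ∏ v : Bulk bd, (((Fintype.card (VIdx D v.1) : ℕ) : ℂ) *
        ((Fintype.card (VIdx D v.1) : ℕ) + 1))⁻¹ with hc
  have h2 : ∀ (b b' : RIdx D bd) (t t' : (v : Bulk bd) → VIdx D v.1),
      ∫ T : Tensors D bd, ∑ u : (v : Bulk bd) → VIdx D v.1,
        ∑ u' : (v : Bulk bd) → VIdx D v.1,
        (∏ v, (T v (u v) * T v (u' v) * star (T v (t v)) * star (T v (t' v)))) *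
        K b b' t t' u u' ∂haarTensors D bd =
      ∑ r : Finset (Bulk bd), c * K b b' t t' (mix (· ∈ r) t' t) (mix (· ∈ r) t t') := by
    intro b b' t t'
    rw [integral_finsetSum _ fun u _ => integrable_finsetSum _ fun u' _ => hint b b' t t' u u']
    simp_rw [integral_finsetSum Finset.univ fun u' _ => hint b b' t t' _ u', integral_mul_const,
      integral_haarTensors_four, ← hc, Finset.mul_sum, Finset.sum_mul]
    calc _ = ∑ r : Finset (Bulk bd), ∑ u, ∑ u',
          c * (if u = mix (· ∈ r) t' t ∧ u' = mix (· ∈ r) t t' then 1 else 0) *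
            K b b' t t' u u' := by
          rw [sum_rotate]
      _ = _ := by
          refine Finset.sum_congr rfl fun r _ => ?_
          rw [Finset.sum_eq_single (mix (· ∈ r) t' t), Finset.sum_eq_single (mix (· ∈ r) t t')]
          · simp
          · intro u' _ h; simp [h]
          · simp
          · intro u _ h; simp [h]
          · simp
  have h4 : ∀ (b b' : RIdx D bd),
      ∫ T : Tensors D bd, ∑ t : (v : Bulk bd) → VIdx D v.1,
        ∑ t' : (v : Bulk bd) → VIdx D v.1, ∑ u : (v : Bulk bd) → VIdx D v.1,
        ∑ u' : (v : Bulk bd) → VIdx D v.1,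
        (∏ v, (T v (u v) * T v (u' v) * star (T v (t v)) * star (T v (t' v)))) *
        K b b' t t' u u' ∂haarTensors D bd =
      ∑ r : Finset (Bulk bd), c *
        ∑ t, ∑ t', K b b' t t' (mix (· ∈ r) t' t) (mix (· ∈ r) t t') := by
    intro b b'
    rw [integral_finsetSum _ fun t _ => integrable_finsetSum _ fun t' _ => hint2 b b' t t']
    simp_rw [integral_finsetSum Finset.univ fun t' _ => hint2 b b' _ t', h2, Finset.mul_sum]
    rw [sum_rotate]
  have hZ : ∀ r : Finset (Bulk bd), ∑ b : RIdx D bd, ∑ b' : RIdx D bd,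
      ∑ t : (v : Bulk bd) → VIdx D v.1, ∑ t' : (v : Bulk bd) → VIdx D v.1,
        K b b' t t' (mix (· ∈ r) t' t) (mix (· ∈ r) t t') =
      ∏ e ∈ cutSurface G (S ∪ r.map (Function.Embedding.subtype _)), ((D e : ℕ) : ℂ)⁻¹ := by
    intro r
    rw [← sum_swap_bondAmplitude Ψ hΨ, ← sum_join]
    refine Finset.sum_congr rfl fun b _ => ?_
    rw [Finset.sum_comm]
    refine Finset.sum_congr rfl fun t _ => ?_
    rw [← sum_join]
    refine Finset.sum_congr rfl fun b' _ => Finset.sum_congr rfl fun t' _ => ?_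
    simp only [hK, join_mix D bd hS]
    rfl
  simp_rw [integral_finsetSum Finset.univ fun b' _ => hint4 _ b', h4]
  rw [sum_rotate, Finset.mul_sum]
  refine Finset.sum_congr rfl fun r _ => ?_
  simp_rw [← Finset.mul_sum]
  rw [hZ]

end StateMoments

/-! ### The reduced density matrix and its rank -/

section Reduced

variable {V : Type*} [Fintype V] [DecidableEq V] {G : SimpleGraph V} [DecidableRel G.Adj]
  (D : G.edgeSet → ℕ+) (Ψ : (e : G.edgeSet) → EIdx D e → ℂ) {S S' : Finset V}

omit [Fintype V] [DecidableRel G.Adj] in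
theorem glue_apply_left (a : RIdx D S) (c : RIdx D S') (v : V) (hv : v ∈ S)
    (h : v ∈ S ∪ S') : glue a c ⟨v, h⟩ = a ⟨v, hv⟩ := by
  simp [glue, hv]

omit [Fintype V] [DecidableRel G.Adj] in
theorem glue_apply_right (hd : Disjoint S S') (a : RIdx D S) (c : RIdx D S') (v : V) (hv : v ∈ S')
    (h : v ∈ S ∪ S') : glue a c ⟨v, h⟩ = c ⟨v, hv⟩ := by
  have : v ∉ S := fun h' => Finset.disjoint_left.mp hd h' hv
  simp [glue, this]

/-- For disjoint regions, juxtaposition of labels is a bijection. -/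
def glueEquiv (hd : Disjoint S S') : RIdx D S × RIdx D S' ≃ RIdx D (S ∪ S') where
  toFun p := glue p.1 p.2
  invFun b := (fun v => b ⟨v.1, Finset.mem_union_left _ v.2⟩,
    fun v => b ⟨v.1, Finset.mem_union_right _ v.2⟩)
  left_inv p := by
    refine Prod.ext (funext fun v => ?_) (funext fun v => ?_)
    · exact glue_apply_left D _ _ _ v.2 _
    · exact glue_apply_right D hd _ _ _ v.2 _
  right_inv b := by
    funext ⟨v, hv⟩
    by_cases h : v ∈ S
    · exact glue_apply_left D _ _ _ h _
    · exact glue_apply_right D hd _ _ _ ((Finset.mem_union.mp hv).resolve_left h) _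

theorem sum_glue (hd : Disjoint S S') (f : RIdx D (S ∪ S') → ℂ) :
    ∑ a : RIdx D S, ∑ c : RIdx D S', f (glue a c) = ∑ b, f b := by
  rw [← Fintype.sum_prod_type' (f := fun a c => f (glue a c))]
  exact Fintype.sum_equiv (glueEquiv D hd) _ _ fun _ => rfl

omit [Fintype V] [DecidableRel G.Adj] in
theorem mix_glue (hd : Disjoint S S') (a a' : RIdx D S) (c c' : RIdx D S') :
    mix (fun v : (S ∪ S' : Finset V) => v.1 ∈ S) (glue a' c') (glue a c) = glue a' c := by
  funext ⟨v, hv⟩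
  by_cases h : v ∈ S
  · simp [mix, h, glue_apply_left]
  · have h' := (Finset.mem_union.mp hv).resolve_left h
    simp [mix, h, glue_apply_right D hd _ _ v h']

/-- The unnormalized state as a matrix from the labels of `S'` to those of `S`. -/
def stateMatrix (T : Tensors D (S ∪ S')) : Matrix (RIdx D S) (RIdx D S') ℂ :=
  Matrix.of fun a c => unnormalizedState D Ψ (S ∪ S') T (glue a c)

/-- The squared norm of the unnormalized state. -/
def normSq {bd : Finset V} (T : Tensors D bd) : ℝ := ∑ b, ‖unnormalizedState D Ψ bd T b‖ ^ 2

theorem normSq_nonneg {bd : Finset V} (T : Tensors D bd) : 0 ≤ normSq D Ψ T :=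
  Finset.sum_nonneg fun _ _ => by positivity

theorem ofReal_normSq {bd : Finset V} (T : Tensors D bd) : (normSq D Ψ T : ℂ) =
    ∑ b, unnormalizedState D Ψ bd T b * star (unnormalizedState D Ψ bd T b) := by
  rw [normSq, Complex.ofReal_sum]
  refine Finset.sum_congr rfl fun b _ => ?_
  rw [Complex.star_def, Complex.mul_conj, Complex.normSq_eq_norm_sq]

/-- If the unnormalized state vanishes, both sides are zero by `x / 0 = 0`. -/
theorem reducedDensity_eq (T : Tensors D (S ∪ S')) : reducedDensity D Ψ S S' T =
    (((normSq D Ψ T)⁻¹ : ℝ) : ℂ) • (stateMatrix D Ψ T * (stateMatrix D Ψ T)ᴴ) := by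
  ext a a'
  simp only [reducedDensity, Matrix.of_apply, Matrix.smul_apply, Matrix.mul_apply,
    Matrix.conjTranspose_apply, stateMatrix, smul_eq_mul, Finset.mul_sum]
  refine Finset.sum_congr rfl fun c _ => ?_
  have hs : (√(normSq D Ψ T) : ℂ) * (√(normSq D Ψ T) : ℂ) = (normSq D Ψ T : ℂ) := by
    rw [← Complex.ofReal_mul, Real.mul_self_sqrt (normSq_nonneg D Ψ T)]
  simp only [state]
  change _ / (√(normSq D Ψ T) : ℂ) * star (_ / (√(normSq D Ψ T) : ℂ)) = _
  rw [star_div₀, Complex.star_def, Complex.conj_ofReal, div_mul_div_comm, hs, Complex.ofReal_inv,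
    div_eq_inv_mul]

theorem posSemidef_reducedDensity (T : Tensors D (S ∪ S')) :
    (reducedDensity D Ψ S S' T).PosSemidef := by
  rw [reducedDensity_eq]
  refine (Matrix.posSemidef_self_mul_conjTranspose _).smul ?_
  exact Complex.zero_le_real.mpr (inv_nonneg.mpr (normSq_nonneg D Ψ T))

theorem trace_stateMatrix (hd : Disjoint S S') (T : Tensors D (S ∪ S')) :
    (stateMatrix D Ψ T * (stateMatrix D Ψ T)ᴴ).trace = (normSq D Ψ T : ℂ) := by
  rw [ofReal_normSq, ← sum_glue D hd]
  rfl

theorem swapMoment_empty {bd : Finset V} (T : Tensors D bd) :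
    swapMoment Ψ ∅ T = ((normSq D Ψ T ^ 2 : ℝ) : ℂ) := by
  rw [Complex.ofReal_pow, ofReal_normSq, pow_two, Finset.sum_mul_sum]
  refine Finset.sum_congr rfl fun b _ => Finset.sum_congr rfl fun b' _ => ?_
  have : ∀ x y : RIdx D bd, mix (fun v : bd => v.1 ∈ (∅ : Finset V)) x y = y := fun x y => by
    funext v; simp [mix]
  rw [this, this]
  ring

theorem trace_stateMatrix_sq (hd : Disjoint S S') (T : Tensors D (S ∪ S')) :
    (stateMatrix D Ψ T * (stateMatrix D Ψ T)ᴴ * (stateMatrix D Ψ T * (stateMatrix D Ψ T)ᴴ)).trace =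
      swapMoment Ψ S T := by
  set ψ := unnormalizedState D Ψ (S ∪ S') T with hψ
  have h1 : (swapMoment Ψ S T : ℂ) = ∑ a : RIdx D S, ∑ c : RIdx D S', ∑ a' : RIdx D S,
      ∑ c' : RIdx D S', ψ (glue a c) * ψ (glue a' c') * star (ψ (glue a' c)) *
        star (ψ (glue a c')) := by
    rw [swapMoment, ← sum_glue D hd]
    refine Finset.sum_congr rfl fun a _ => Finset.sum_congr rfl fun c _ => ?_
    rw [← sum_glue D hd]
    refine Finset.sum_congr rfl fun a' _ => Finset.sum_congr rfl fun c' _ => ?_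
    rw [mix_glue D hd, mix_glue D hd]
  rw [h1, Matrix.trace]
  refine Finset.sum_congr rfl fun a _ => ?_
  rw [Matrix.diag_apply, Matrix.mul_apply, Finset.sum_comm]
  refine Finset.sum_congr rfl fun a' _ => ?_
  rw [Matrix.mul_apply, Matrix.mul_apply, Finset.sum_mul_sum]
  refine Finset.sum_congr rfl fun c _ => Finset.sum_congr rfl fun c' _ => ?_
  simp only [Matrix.conjTranspose_apply, stateMatrix, Matrix.of_apply, ← hψ]
  ring

theorem measurable_unnormalizedState {bd : Finset V} (b : RIdx D bd) :
    Measurable fun T : Tensors D bd => unnormalizedState D Ψ bd T b := by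
  simp_rw [unnormalizedState_eq]
  fun_prop

theorem measurable_normSq {bd : Finset V} :
    Measurable fun T : Tensors D bd => normSq D Ψ T :=
  Finset.measurable_sum _ fun b _ => (measurable_unnormalizedState D Ψ b).norm.pow_const 2

theorem measurable_reducedDensity (a a' : RIdx D S) :
    Measurable fun T : Tensors D (S ∪ S') => reducedDensity D Ψ S S' T a a' := by
  simp_rw [reducedDensity_eq, Matrix.smul_apply, Matrix.mul_apply, Matrix.conjTranspose_apply,
    stateMatrix, Matrix.of_apply]
  have h1 := fun b => measurable_unnormalizedState D Ψ (bd := S ∪ S') b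
  refine Measurable.smul (Complex.measurable_ofReal.comp (measurable_normSq D Ψ).inv) ?_
  exact Finset.measurable_sum _ fun c _ => (h1 _).mul (continuous_star.measurable.comp (h1 _))

/-- The Schmidt rank across a cut is at most the product of the bond dimensions on the cut surface:
the contraction of the network factors through the labels of the cut edges. -/
theorem rank_stateMatrix_le {r : Finset V} (hr : IsCut S S' r) (hd : Disjoint S S')
    (T : Tensors D (S ∪ S')) :
    (stateMatrix D Ψ T).rank ≤ ∏ e ∈ cutSurface G r, (D e : ℕ) := by
  classical
  let Γ : Type _ := (e : cutSurface G r) → Fin (D e.1 : ℕ)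
  have hΓ : Fintype.card Γ = ∏ e ∈ cutSurface G r, (D e : ℕ) := by
    simp only [Γ, Fintype.card_pi, Fintype.card_fin]
    exact Finset.prod_coe_sort (cutSurface G r) fun e => (D e : ℕ)
  have hend : ∀ e : cutSurface G r, ∃ u ∈ r, u ∈ (e.1 : Sym2 V) := fun e =>
    (Finset.mem_filter.mp e.2).2.1
  choose u hur hue using hend
  -- The weight of a configuration `x` is `P a x * Q c (κ x) x`, where `P` and `κ` depend on the labels
  -- of `x` in `r` only and `Q` on those outside `r`. Edges that leave `r` are collected in `Q`, which
  -- reads their labels at the end in `r` from `κ x`; the default label `0` is never used.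
  let Inside : G.edgeSet → Prop := fun e => ∀ v ∈ (e : Sym2 V), v ∈ r
  let κ : ((v : V) → VIdx D v) → Γ := fun x e => x (u e) ⟨e.1, hue e⟩
  let P : (a : RIdx D S) → ((v : V) → VIdx D v) → ℂ := fun a x =>
    (if ∀ v : S, x v = a v then 1 else 0) *
      (∏ v ∈ Finset.univ.filter (fun v : Bulk (S ∪ S') => v.1 ∈ r), star (T v (x v))) *
      ∏ e ∈ Finset.univ.filter Inside, Ψ e fun v => x v.1 ⟨e, v.2⟩
  let Q : (c : RIdx D S') → Γ → ((v : V) → VIdx D v) → ℂ := fun c γ x =>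
    (if ∀ v : S', x v = c v then 1 else 0) *
      (∏ v ∈ Finset.univ.filter (fun v : Bulk (S ∪ S') => ¬ v.1 ∈ r), star (T v (x v))) *
      ∏ e ∈ Finset.univ.filter (fun e => ¬ Inside e), Ψ e fun v =>
        if v.1 ∈ r then (if h : e ∈ cutSurface G r then γ ⟨e, h⟩ else ⟨0, (D e).pos⟩)
        else x v.1 ⟨e, v.2⟩
  have hP : ∀ a x x', (∀ v ∈ r, x v = x' v) → P a x = P a x' := by
    intro a x x' h
    simp only [P]
    congr 1
    · congr 1
      · refine if_congr (forall_congr' fun v => ?_) rfl rfl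
        rw [h v.1 (hr.1 v.2)]
      · refine Finset.prod_congr rfl fun v hv => ?_
        rw [h v.1 (Finset.mem_filter.mp hv).2]
    · refine Finset.prod_congr rfl fun e he => ?_
      congr 1
      funext v
      rw [h v.1 ((Finset.mem_filter.mp he).2 v.1 v.2)]
  have hQ : ∀ c γ x x', (∀ v, v ∉ r → x v = x' v) → Q c γ x = Q c γ x' := by
    intro c γ x x' h
    simp only [Q]
    congr 1
    · congr 1
      · refine if_congr (forall_congr' fun v => ?_) rfl rfl
        rw [h v.1 (Finset.mem_compl.mp (hr.2 v.2))]
      · refine Finset.prod_congr rfl fun v hv => ?_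
        rw [h v.1 (Finset.mem_filter.mp hv).2]
    · refine Finset.prod_congr rfl fun e he => ?_
      congr 1
      funext v
      split_ifs with h1
      · rfl
      · rfl
      · rw [h v.1 h1]
  have hκ : ∀ x x', (∀ v ∈ r, x v = x' v) → κ x = κ x' := by
    intro x x' h
    funext e
    simp only [κ]
    rw [h _ (hur e)]
  have hfac : ∀ a c x, (if (∀ v : (S ∪ S' : Finset V), x v = glue a c v) then
      (∏ v : Bulk (S ∪ S'), star (T v (x v.1))) *
        ∏ e : G.edgeSet, Ψ e fun v => x v.1 ⟨e, v.2⟩ else 0) = P a x * Q c (κ x) x := by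
    intro a c x
    have hcond : (∀ v : (S ∪ S' : Finset V), x v = glue a c v) ↔
        (∀ v : S, x v = a v) ∧ ∀ v : S', x v = c v := by
      constructor
      · intro h
        refine ⟨fun v => ?_, fun v => ?_⟩
        · rw [← glue_apply_left D a c v.1 v.2 (Finset.mem_union_left _ v.2)]
          exact h ⟨v.1, _⟩
        · rw [← glue_apply_right D hd a c v.1 v.2 (Finset.mem_union_right _ v.2)]
          exact h ⟨v.1, _⟩
      · rintro ⟨h1, h2⟩ ⟨v, hv⟩
        by_cases h : v ∈ S
        · rw [glue_apply_left D a c v h]; exact h1 ⟨v, h⟩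
        · have h' := (Finset.mem_union.mp hv).resolve_left h
          rw [glue_apply_right D hd a c v h']; exact h2 ⟨v, h'⟩
    have hedge : ∏ e ∈ Finset.univ.filter (fun e => ¬ Inside e), (Ψ e fun v =>
        if v.1 ∈ r then (if h : e ∈ cutSurface G r then κ x ⟨e, h⟩ else ⟨0, (D e).pos⟩)
        else x v.1 ⟨e, v.2⟩) =
        ∏ e ∈ Finset.univ.filter (fun e => ¬ Inside e), Ψ e fun v => x v.1 ⟨e, v.2⟩ := by
      refine Finset.prod_congr rfl fun e he => ?_
      congr 1
      funext v
      split_ifs with h1 h2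
      · have hne := (Finset.mem_filter.mp he).2
        have : u ⟨e, h2⟩ = v.1 := by
          by_contra hcon
          refine hne fun w hw => ?_
          obtain ⟨x', -, hall⟩ := exists_other_vertex e v
          have hx' : (⟨u ⟨e, h2⟩, hue ⟨e, h2⟩⟩ : {v : V // v ∈ (e : Sym2 V)}) = x' :=
            (hall _).resolve_left fun h => hcon (congrArg Subtype.val h)
          rcases hall ⟨w, hw⟩ with h | h
          · rw [show w = v.1 from congrArg Subtype.val h]; exact h1
          · rw [show w = u ⟨e, h2⟩ from congrArg Subtype.val (h.trans hx'.symm)]; exact hur _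
        simp only [κ]
        obtain ⟨v, hv⟩ := v
        subst this
        rfl
      · refine absurd ?_ h2
        have hne := (Finset.mem_filter.mp he).2
        simp only [Inside, not_forall] at hne
        obtain ⟨w, hw, hwr⟩ := hne
        simp only [cutSurface, Finset.mem_filter, Finset.mem_univ, true_and]
        exact ⟨⟨v.1, h1, v.2⟩, w, Finset.mem_compl.mpr hwr, hw⟩
      · rfl
    simp only [P, Q, hedge]
    rw [← Finset.prod_filter_mul_prod_filter_not Finset.univ
      (fun v : Bulk (S ∪ S') => v.1 ∈ r), ← Finset.prod_filter_mul_prod_filter_not Finset.univ Inside]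
    by_cases h1 : ∀ v : S, x v = a v
    · by_cases h2 : ∀ v : S', x v = c v
      · rw [if_pos (hcond.mpr ⟨h1, h2⟩), if_pos h1, if_pos h2]; ring
      · rw [if_neg fun h => h2 (hcond.mp h).2, if_neg h2]; ring
    · rw [if_neg fun h => h1 (hcond.mp h).1, if_neg h1]; ring
  let z₀ : (v : Bulk r) → VIdx D v.1 := fun _ _ => ⟨0, PNat.pos _⟩
  let y₀ : RIdx D r := fun _ _ => ⟨0, PNat.pos _⟩
  have hjoin : ∀ y z z', ∀ v ∈ r, join D r y z v = join D r y z' v := fun y z z' v hv => by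
    rw [join_apply_boundary D r y z ⟨v, hv⟩, join_apply_boundary D r y z' ⟨v, hv⟩]
  have hjoin' : ∀ y y' z, ∀ v, v ∉ r → join D r y z v = join D r y' z v := fun y y' z v hv => by
    rw [join_apply_bulk D r y z ⟨v, hv⟩, join_apply_bulk D r y' z ⟨v, hv⟩]
  have hmul : stateMatrix D Ψ T =
      (Matrix.of fun a γ => ∑ y, if κ (join D r y z₀) = γ then P a (join D r y z₀) else 0 :
        Matrix (RIdx D S) Γ ℂ) *
      (Matrix.of fun γ c => ∑ z, Q c γ (join D r y₀ z) : Matrix Γ (RIdx D S') ℂ) := by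
    ext a c
    rw [Matrix.mul_apply]
    simp only [Matrix.of_apply]
    have h1 : stateMatrix D Ψ T a c = ∑ x, P a x * Q c (κ x) x := by
      simp_rw [← hfac]
      rfl
    rw [h1, ← sum_join (bd := r)]
    simp_rw [Finset.sum_mul]
    conv_rhs => rw [Finset.sum_comm]
    refine Finset.sum_congr rfl fun y _ => ?_
    simp_rw [ite_mul, zero_mul]
    rw [Finset.sum_ite_eq, if_pos (Finset.mem_univ _), Finset.mul_sum]
    refine Finset.sum_congr rfl fun z _ => ?_
    rw [hP a _ _ (hjoin y z z₀), hκ _ _ (hjoin y z z₀), hQ c _ _ _ (hjoin' y y₀ z)]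
  rw [hmul, ← hΓ]
  exact (Matrix.rank_mul_le_left _ _).trans (Matrix.rank_le_card_width _)

end Reduced

/-! ### Areas of cuts and Ising partition functions -/

section CutBounds

variable {V : Type*} [Fintype V] [DecidableEq V] {G : SimpleGraph V} [DecidableRel G.Adj]
  {w : G.edgeSet → ℝ}

theorem cutSurface_symmDiff_subset (r s : Finset V) :
    cutSurface G (symmDiff r s) ⊆ cutSurface G r ∪ cutSurface G s := by
  intro e he
  simp only [cutSurface, Finset.mem_union, Finset.mem_filter, Finset.mem_univ, true_and,
    Finset.mem_compl, Finset.mem_symmDiff] at he ⊢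
  obtain ⟨⟨x, hx, hxe⟩, y, hy, hye⟩ := he
  by_cases h1 : x ∈ r <;> by_cases h2 : y ∈ r <;> by_cases h3 : x ∈ s <;> by_cases h4 : y ∈ s <;>
    grind

theorem area_symmDiff_le (hw : ∀ e, 0 ≤ w e) (r s : Finset V) :
    area G w (symmDiff r s) ≤ area G w r + area G w s := by
  calc area G w (symmDiff r s) ≤ ∑ e ∈ cutSurface G r ∪ cutSurface G s, w e :=
        Finset.sum_le_sum_of_subset_of_nonneg (cutSurface_symmDiff_subset r s) fun e _ _ => hw e
    _ ≤ ∑ e ∈ cutSurface G r ∪ cutSurface G s, w e +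
        ∑ e ∈ cutSurface G r ∩ cutSurface G s, w e :=
        le_add_of_nonneg_right (Finset.sum_nonneg fun e _ => hw e)
    _ = _ := Finset.sum_union_inter

/-- Flipping a nonempty bulk region in the entanglement wedge gives another cut, so the gap bounds
the area of every nonempty bulk region from below. -/
theorem IsUniqueEntanglementWedge.gap_le_area (hw : ∀ e, 0 ≤ w e) {S S' r₀ : Finset V} {g : ℝ}
    (h : IsUniqueEntanglementWedge G w S S' g r₀) {s : Finset V} (hs : s.Nonempty)
    (hS : Disjoint s (S ∪ S')) : g ≤ area G w s := by
  obtain ⟨⟨h1, h2⟩, hmin, hgap⟩ := h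
  have hcut : IsCut S S' (symmDiff r₀ s) := by
    constructor
    · intro v hv
      have : v ∉ s := fun h => Finset.disjoint_left.mp hS h (Finset.mem_union_left _ hv)
      simp [Finset.mem_symmDiff, h1 hv, this]
    · intro v hv
      have : v ∉ s := fun h => Finset.disjoint_left.mp hS h (Finset.mem_union_right _ hv)
      have h3 := Finset.mem_compl.mp (h2 hv)
      simp [h3, this]
  have hne : symmDiff r₀ s ≠ r₀ := fun h => hs.ne_empty (symmDiff_eq_left.mp h)
  have := hgap _ hcut hne
  have := area_symmDiff_le hw r₀ s
  linarith

omit [Fintype V] [DecidableEq V] [DecidableRel G.Adj] in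
theorem bondDim_eq_rpow {χ : ℝ} (hχ : 1 < χ) {D : G.edgeSet → ℕ+}
    (hD : ∀ e, w e = Real.log (D e : ℕ) / Real.log χ) (e : G.edgeSet) :
    ((D e : ℕ) : ℝ) = χ ^ w e := by
  have hlog : Real.log χ ≠ 0 := (Real.log_pos hχ).ne'
  have hpos : (0 : ℝ) < (D e : ℕ) := by exact_mod_cast (D e).pos
  rw [Real.rpow_def_of_pos (by linarith), hD e, mul_div_cancel₀ _ hlog, Real.exp_log hpos]

theorem prod_bondDim {χ : ℝ} (hχ : 1 < χ) {D : G.edgeSet → ℕ+}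
    (hD : ∀ e, w e = Real.log (D e : ℕ) / Real.log χ) (r : Finset V) :
    ∏ e ∈ cutSurface G r, ((D e : ℕ) : ℝ) = χ ^ area G w r := by
  rw [area, Real.rpow_sum_of_pos (by linarith)]
  exact Finset.prod_congr rfl fun e _ => bondDim_eq_rpow hχ hD e

theorem prod_inv_bondDim {χ : ℝ} (hχ : 1 < χ) {D : G.edgeSet → ℕ+}
    (hD : ∀ e, w e = Real.log (D e : ℕ) / Real.log χ) (r : Finset V) :
    ∏ e ∈ cutSurface G r, ((D e : ℕ) : ℂ)⁻¹ = ((χ ^ (-area G w r) : ℝ) : ℂ) := by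
  rw [Real.rpow_neg (by linarith), ← prod_bondDim hχ hD, Finset.prod_inv_distrib]
  push_cast
  rfl

/-- An Ising partition function with one ground state and all other weights suppressed by `q`. -/
theorem sum_le_of_unique_ground_state {bd : Finset V} (f : Finset (Bulk bd) → ℝ)
    (r₁ : Finset (Bulk bd)) {c q : ℝ} (hc : 0 ≤ c) (hq : 0 ≤ q) (h₁ : f r₁ ≤ c)
    (h : ∀ r, r ≠ r₁ → f r ≤ c * q) :
    ∑ r, f r ≤ c * (1 + 2 ^ Fintype.card V * q) := by
  have hle : ∀ r, f r ≤ c * ((if r = r₁ then 1 else 0) + q) := by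
    intro r
    split_ifs with hr
    · subst hr; nlinarith [mul_nonneg hc hq]
    · simpa using h r hr
  have hcard : (Fintype.card (Finset (Bulk bd)) : ℝ) ≤ 2 ^ Fintype.card V := by
    rw [Fintype.card_finset]
    push_cast
    exact pow_le_pow_right₀ (by norm_num) (Fintype.card_subtype_le _)
  calc ∑ r, f r ≤ ∑ r, c * ((if r = r₁ then 1 else 0) + q) := Finset.sum_le_sum fun r _ => hle r
    _ = c * (1 + Fintype.card (Finset (Bulk bd)) * q) := by
        rw [← Finset.mul_sum, Finset.sum_add_distrib]
        simp
    _ ≤ c * (1 + 2 ^ Fintype.card V * q) := by gcongr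

/-- The squared norm to the power two has a partition function dominated by the empty region. -/
theorem sum_area_empty_le {χ : ℝ} (hχ : 1 < χ) (hw : ∀ e, 0 ≤ w e) {S S' r₀ : Finset V} {g : ℝ}
    (h : IsUniqueEntanglementWedge G w S S' g r₀) :
    ∑ r : Finset (Bulk (S ∪ S')), χ ^ (-area G w (∅ ∪ r.map (Function.Embedding.subtype _))) ≤
      1 + 2 ^ Fintype.card V * χ ^ (-g) := by
  have hχ0 : 0 < χ := by linarith
  have := sum_le_of_unique_ground_state (bd := S ∪ S')
    (fun r => χ ^ (-area G w (∅ ∪ r.map (Function.Embedding.subtype _)))) ∅ zero_le_one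
    (Real.rpow_nonneg hχ0.le (-g)) (by simp [area, cutSurface]) (by
      intro r hr
      rw [one_mul]
      refine Real.rpow_le_rpow_of_exponent_le hχ.le (neg_le_neg ?_)
      rw [Finset.empty_union]
      refine h.gap_le_area hw ((Finset.nonempty_iff_ne_empty.mpr hr).map) ?_
      rw [Finset.disjoint_left]
      intro v hv
      obtain ⟨u, -, rfl⟩ := Finset.mem_map.mp hv
      exact u.2)
  rwa [one_mul] at this

/-- The purity has a partition function dominated by the entanglement wedge. -/
theorem sum_area_le {χ : ℝ} (hχ : 1 < χ) {S S' r₀ : Finset V} (hd : Disjoint S S') {g : ℝ}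
    (h : IsUniqueEntanglementWedge G w S S' g r₀) :
    ∑ r : Finset (Bulk (S ∪ S')), χ ^ (-area G w (S ∪ r.map (Function.Embedding.subtype _))) ≤
      χ ^ (-minCut G w S S') * (1 + 2 ^ Fintype.card V * χ ^ (-g)) := by
  have hχ0 : 0 < χ := by linarith
  have hcut : ∀ r : Finset (Bulk (S ∪ S')),
      IsCut S S' (S ∪ r.map (Function.Embedding.subtype _)) := by
    intro r
    refine ⟨Finset.subset_union_left, fun v hv => ?_⟩
    have : v ∉ S := fun h' => Finset.disjoint_left.mp hd h' hv
    simp [this, hv]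
  obtain ⟨-, hmin, hgap⟩ := h
  refine sum_le_of_unique_ground_state (bd := S ∪ S') _
    (Finset.univ.filter fun v : Bulk (S ∪ S') => v.1 ∈ r₀) (Real.rpow_nonneg hχ0.le _)
    (Real.rpow_nonneg hχ0.le (-g)) ?_ ?_
  · refine Real.rpow_le_rpow_of_exponent_le hχ.le (neg_le_neg ?_)
    exact ciInf_le (Set.finite_range _).bddBelow
      (⟨_, hcut _⟩ : {r : Finset V // IsCut S S' r})
  · intro r hr
    rw [← Real.rpow_add hχ0]
    refine Real.rpow_le_rpow_of_exponent_le hχ.le ?_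
    have hne : S ∪ r.map (Function.Embedding.subtype _) ≠ r₀ := by
      intro heq
      apply hr
      ext v
      have hv : v.1 ∉ S := fun hv => v.2 (Finset.mem_union_left _ hv)
      rw [← heq]
      simp only [Finset.mem_filter, Finset.mem_univ, true_and, Finset.mem_union, hv, false_or]
      exact (Finset.mem_map' (Function.Embedding.subtype _)).symm
    have := hgap _ (hcut r) hne
    linarith

end CutBounds

/-! ### Concentration of the reduced state -/

section Concentration

variable {V : Type*} [Fintype V] [DecidableEq V] {G : SimpleGraph V} [DecidableRel G.Adj]
  {w : G.edgeSet → ℝ} {D : G.edgeSet → ℕ+} (Ψ : (e : G.edgeSet) → EIdx D e → ℂ)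

theorem meanNorm_pos (bd : Finset V) : 0 < meanNorm D bd :=
  Finset.prod_pos fun _ _ => inv_pos.mpr (Nat.cast_pos.mpr Fintype.card_pos)

theorem integral_normSq {bd : Finset V} (hΨ : ∀ e, IsMaxEntangled D e (Ψ e)) :
    Integrable (fun T : Tensors D bd => normSq D Ψ T) (haarTensors D bd) ∧
      ∫ T : Tensors D bd, normSq D Ψ T ∂haarTensors D bd = meanNorm D bd := by
  obtain ⟨h1, h2⟩ := integral_sum_unnormalizedState_mul_star Ψ (bd := bd) hΨ
  simp_rw [← ofReal_normSq] at h1 h2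
  refine ⟨by simpa using h1.re, ?_⟩
  rw [integral_complex_ofReal] at h2
  exact_mod_cast h2

/-- The second moments are bounded by the Ising partition functions, as `d (d + 1) ≥ d²`. -/
theorem integral_re_swapMoment_le {bd : Finset V} (hΨ : ∀ e, IsMaxEntangled D e (Ψ e)) {χ : ℝ}
    (hχ : 1 < χ) (hD : ∀ e, w e = Real.log (D e : ℕ) / Real.log χ) {S : Finset V} (hS : S ⊆ bd) :
    Integrable (fun T : Tensors D bd => (swapMoment Ψ S T).re) (haarTensors D bd) ∧
      ∫ T : Tensors D bd, (swapMoment Ψ S T).re ∂haarTensors D bd ≤ meanNorm D bd ^ 2 *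
        ∑ r : Finset (Bulk bd), χ ^ (-area G w (S ∪ r.map (Function.Embedding.subtype _))) := by
  obtain ⟨h1, h2⟩ := integral_swapMoment Ψ hΨ hS
  refine ⟨h1.re, ?_⟩
  have h3 : ∫ T : Tensors D bd, (swapMoment Ψ S T).re ∂haarTensors D bd =
      (∫ T : Tensors D bd, swapMoment Ψ S T ∂haarTensors D bd).re := integral_re h1
  have h4 : (∏ v : Bulk bd, (((Fintype.card (VIdx D v.1) : ℕ) : ℂ) *
        ((Fintype.card (VIdx D v.1) : ℕ) + 1))⁻¹) *
      ∑ r : Finset (Bulk bd),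
        ∏ e ∈ cutSurface G (S ∪ r.map (Function.Embedding.subtype _)), ((D e : ℕ) : ℂ)⁻¹ =
      (((∏ v : Bulk bd, (((Fintype.card (VIdx D v.1) : ℕ) : ℝ) *
        ((Fintype.card (VIdx D v.1) : ℕ) + 1))⁻¹) *
      ∑ r : Finset (Bulk bd),
        χ ^ (-area G w (S ∪ r.map (Function.Embedding.subtype _))) : ℝ) : ℂ) := by
    simp_rw [prod_inv_bondDim hχ hD]
    push_cast
    rfl
  rw [h3, h2, h4, Complex.ofReal_re]
  refine mul_le_mul_of_nonneg_right ?_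
    (Finset.sum_nonneg fun r _ => Real.rpow_nonneg (by linarith) _)
  rw [meanNorm, ← Finset.prod_pow]
  refine Finset.prod_le_prod (fun v _ => by positivity) fun v _ => ?_
  have hpos : (0 : ℝ) < (Fintype.card (VIdx D v.1) : ℕ) := Nat.cast_pos.mpr Fintype.card_pos
  rw [inv_pow]
  refine inv_anti₀ (by positivity) ?_
  nlinarith

variable {S S' : Finset V}

/-- The distance of the reduced state from the flat state, for each choice of tensors. -/
theorem traceNorm_reducedDensity_bounds {r₀ : Finset V} (hcut : IsCut S S' r₀)
    (hd : Disjoint S S') (T : Tensors D (S ∪ S')) {R : ℕ}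
    (hR : R = ∏ e ∈ cutSurface G r₀, (D e : ℕ)) :
    traceNorm (reducedDensity D Ψ S S' T - (((R : ℝ)⁻¹ : ℝ) : ℂ) •
        supportProj (reducedDensity D Ψ S S' T)) ≤ 2 ∧
      (normSq D Ψ T * traceNorm (reducedDensity D Ψ S S' T - (((R : ℝ)⁻¹ : ℝ) : ℂ) •
        supportProj (reducedDensity D Ψ S S' T))) ^ 2 ≤
        R * (swapMoment Ψ S T).re - normSq D Ψ T ^ 2 := by
  have hred := reducedDensity_eq D Ψ T
  have hpos := posSemidef_reducedDensity D Ψ T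
  set ρ := reducedDensity D Ψ S S' T with hρ
  set N := normSq D Ψ T with hN
  have htr2 := trace_stateMatrix_sq D Ψ hd T
  have htr := trace_stateMatrix D Ψ hd T
  set M := stateMatrix D Ψ T with hM
  by_cases h0 : N = 0
  · -- The unnormalized state vanishes, hence so does the reduced state as defined by `x / 0 = 0`.
    have hρ0 : ρ = 0 := by rw [hred, h0]; simp
    have hX : traceNorm (ρ - (((R : ℝ)⁻¹ : ℝ) : ℂ) • supportProj ρ) = 0 := by
      rw [traceNorm_sub_smul_supportProj hpos.isHermitian]
      have : hpos.isHermitian.eigenvalues = 0 := hpos.isHermitian.eigenvalues_eq_zero_iff.mpr hρ0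
      simp [this]
    have hMM : M * Mᴴ = 0 := by
      rw [← hN, h0, Complex.ofReal_zero] at htr
      exact Matrix.trace_mul_conjTranspose_self_eq_zero_iff.mp htr ▸ by simp
    rw [hX, h0, ← htr2, hMM]
    simp
  · have hNC : (N : ℂ) ≠ 0 := by exact_mod_cast h0
    have htr1 : ρ.trace = 1 := by
      rw [hred, Matrix.trace_smul, htr, smul_eq_mul, Complex.ofReal_inv, inv_mul_cancel₀ hNC]
    have hrank : ρ.rank ≤ R := by
      rw [hred, hR]
      have h2 : (((N⁻¹ : ℝ) : ℂ) • (M * Mᴴ)).rank ≤ M.rank := by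
        rw [← Matrix.mul_smul]
        exact Matrix.rank_mul_le_left _ _
      exact h2.trans (rank_stateMatrix_le D Ψ hcut hd T)
    obtain ⟨h1, h2⟩ := traceNorm_sub_smul_supportProj_bounds hpos htr1 hrank
    refine ⟨h1, ?_⟩
    have hpur : N ^ 2 * (ρ * ρ).trace.re = (swapMoment Ψ S T).re := by
      rw [← htr2, hred, Matrix.smul_mul, Matrix.mul_smul, smul_smul, Matrix.trace_smul, smul_eq_mul,
        ← Complex.ofReal_mul, Complex.re_ofReal_mul]
      field_simp
    rw [mul_pow, ← hpur]
    nlinarith [mul_le_mul_of_nonneg_left h2 (sq_nonneg N)]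

theorem traceNorm_nonneg {ι : Type*} [Fintype ι] [DecidableEq ι] (M : Matrix ι ι ℂ) :
    0 ≤ traceNorm M :=
  Finset.sum_nonneg fun i _ => (Matrix.toEuclideanLin M).singularValues_nonneg i

theorem measurable_traceNorm_reducedDensity (hd : Disjoint S S') (c : ℝ) :
    Measurable fun T : Tensors D (S ∪ S') => traceNorm (reducedDensity D Ψ S S' T - (c : ℂ) •
      supportProj (reducedDensity D Ψ S S' T)) := by
  refine measurable_traceNorm_sub_smul_supportProj (fun T => reducedDensity D Ψ S S' T)
    (measurable_reducedDensity D Ψ) (fun T => (posSemidef_reducedDensity D Ψ T).isHermitian) ?_ c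
  intro T i
  have hpos := posSemidef_reducedDensity D Ψ T
  refine ⟨hpos.eigenvalues_nonneg i, ?_⟩
  have htr : (reducedDensity D Ψ S S' T).trace.re ≤ 1 := by
    rw [reducedDensity_eq, Matrix.trace_smul, trace_stateMatrix D Ψ hd, smul_eq_mul,
      ← Complex.ofReal_mul, Complex.ofReal_re]
    exact inv_mul_le_one
  have h1 := trace_pow_eq_sum_eigenvalues hpos.isHermitian 1
  simp only [pow_one] at h1
  rw [h1, Complex.ofReal_re] at htr
  exact (Finset.single_le_sum (fun j _ => hpos.eigenvalues_nonneg j) (Finset.mem_univ i)).trans htr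

/-- The concentration bound with the explicit constant `5 / 2 * √(2 ^ |V|)`. -/
theorem integral_traceNorm_le (hd : Disjoint S S') (hw : ∀ e, 0 ≤ w e) {g : ℝ} {r₀ : Finset V}
    (hEW : IsUniqueEntanglementWedge G w S S' g r₀) {χ : ℝ} (hχ : 1 < χ)
    (hD : ∀ e, w e = Real.log (D e : ℕ) / Real.log χ) (hΨ : ∀ e, IsMaxEntangled D e (Ψ e)) :
    Integrable (fun T : Tensors D (S ∪ S') => traceNorm (reducedDensity D Ψ S S' T -
        ((χ ^ minCut G w S S' : ℝ) : ℂ)⁻¹ • supportProj (reducedDensity D Ψ S S' T)))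
      (haarTensors D (S ∪ S')) ∧
    ∫ T : Tensors D (S ∪ S'), traceNorm (reducedDensity D Ψ S S' T -
        ((χ ^ minCut G w S S' : ℝ) : ℂ)⁻¹ • supportProj (reducedDensity D Ψ S S' T))
      ∂haarTensors D (S ∪ S') ≤ 5 / 2 * √(2 ^ Fintype.card V) * χ ^ (-g / 2) := by
  have hχ0 : 0 < χ := by linarith
  set R : ℕ := ∏ e ∈ cutSurface G r₀, (D e : ℕ) with hR
  have hRχ : (R : ℝ) = χ ^ minCut G w S S' := by
    rw [← hEW.2.1, ← prod_bondDim hχ hD, hR]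
    push_cast
    rfl
  rw [← hRχ, ← Complex.ofReal_inv]
  set X : Tensors D (S ∪ S') → ℝ := fun T => traceNorm (reducedDensity D Ψ S S' T -
        (((R : ℝ)⁻¹ : ℝ) : ℂ) • supportProj (reducedDensity D Ψ S S' T)) with hX
  set N : Tensors D (S ∪ S') → ℝ := fun T => normSq D Ψ T with hN
  set Q : Tensors D (S ∪ S') → ℝ := fun T => (swapMoment Ψ S T).re with hQ
  set P := haarTensors D (S ∪ S') with hP
  have hX2 : ∀ T, X T ≤ 2 := fun T =>
    (traceNorm_reducedDensity_bounds Ψ hEW.1 hd T hR).1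
  have hNX : ∀ T, (N T * X T) ^ 2 ≤ R * Q T - N T ^ 2 := fun T =>
    (traceNorm_reducedDensity_bounds Ψ hEW.1 hd T hR).2
  have hX0 : ∀ T, 0 ≤ X T := fun T => traceNorm_nonneg _
  have hXint : Integrable X P :=
    Integrable.of_bound (measurable_traceNorm_reducedDensity Ψ hd _).aestronglyMeasurable 2
      (Filter.Eventually.of_forall fun T => by
        rw [Real.norm_of_nonneg (hX0 T)]; exact hX2 T)
  refine ⟨hXint, ?_⟩
  set m := meanNorm D (S ∪ S') with hm
  have hm0 : 0 < m := meanNorm_pos _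
  set t := √(2 ^ Fintype.card V) * χ ^ (-g / 2) with ht
  have ht0 : 0 < t := mul_pos (Real.sqrt_pos.mpr (by positivity)) (Real.rpow_pos_of_pos hχ0 _)
  have ht2 : 2 ^ Fintype.card V * χ ^ (-g) = t ^ 2 := by
    rw [ht, mul_pow, Real.sq_sqrt (by positivity), ← Real.rpow_natCast (χ ^ (-g / 2)),
      ← Real.rpow_mul hχ0.le]
    congr 2
    push_cast
    ring
  obtain ⟨hN1, hN2⟩ : Integrable N P ∧ ∫ T, N T ∂P = m := integral_normSq Ψ hΨ
  obtain ⟨hNN1, hNN2⟩ : Integrable (fun T => N T ^ 2) P ∧ ∫ T, N T ^ 2 ∂P ≤ m ^ 2 * (1 + t ^ 2) := by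
    obtain ⟨h1, h2⟩ := integral_re_swapMoment_le Ψ hΨ hχ hD (Finset.empty_subset (S ∪ S'))
    simp_rw [swapMoment_empty, Complex.ofReal_re] at h1 h2
    refine ⟨h1, h2.trans (mul_le_mul_of_nonneg_left ?_ (sq_nonneg _))⟩
    rw [← ht2]
    exact sum_area_empty_le hχ hw hEW
  obtain ⟨hQ1, hQ2⟩ : Integrable Q P ∧ ∫ T, R * Q T ∂P ≤ m ^ 2 * (1 + t ^ 2) := by
    obtain ⟨h1, h2⟩ := integral_re_swapMoment_le Ψ hΨ hχ hD
      (Finset.subset_union_left (s₁ := S) (s₂ := S'))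
    refine ⟨h1, ?_⟩
    have h3 := sum_area_le hχ hd hEW
    rw [ht2, Real.rpow_neg hχ0.le, ← hRχ] at h3
    have hR0 : (0 : ℝ) < R := by rw [hRχ]; exact Real.rpow_pos_of_pos hχ0 _
    rw [integral_const_mul]
    calc R * ∫ T, Q T ∂P ≤ R * (m ^ 2 * ((R : ℝ)⁻¹ * (1 + t ^ 2))) := by
          gcongr
          exact h2.trans (mul_le_mul_of_nonneg_left h3 (sq_nonneg _))
      _ = _ := by field_simp
  -- Split `X = ν X + (1 - ν) X` with `ν = N / m` of mean one, and linearize both square roots.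
  have hpt : ∀ T, X T ≤ (R * Q T - N T ^ 2) / (2 * t * m ^ 2) + (N T ^ 2 / m ^ 2 - 2 * (N T / m)) / t
      + (3 / 2 * t + 1 / t) := by
    intro T
    set ν := N T / m with hν
    have hNm : N T = ν * m := by rw [hν]; field_simp
    have h1 : (ν * X T) ^ 2 ≤ (R * Q T - N T ^ 2) / m ^ 2 := by
      rw [le_div_iff₀ (by positivity)]
      calc (ν * X T) ^ 2 * m ^ 2 = (N T * X T) ^ 2 := by rw [hNm]; ring
        _ ≤ _ := hNX T
    have h2 : ν * X T ≤ (ν * X T) ^ 2 / (2 * t) + t / 2 := by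
      have : (ν * X T) ^ 2 / (2 * t) + t / 2 - ν * X T = (ν * X T - t) ^ 2 / (2 * t) := by
        field_simp; ring
      have : 0 ≤ (ν * X T - t) ^ 2 / (2 * t) := by positivity
      linarith
    have h3 : (1 - ν) * X T ≤ (1 - ν) ^ 2 / t + t := by
      have h4 : (1 - ν) * X T ≤ 2 * |1 - ν| := by
        calc (1 - ν) * X T ≤ |1 - ν| * X T := mul_le_mul_of_nonneg_right (le_abs_self _) (hX0 T)
          _ ≤ |1 - ν| * 2 := mul_le_mul_of_nonneg_left (hX2 T) (abs_nonneg _)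
          _ = _ := mul_comm _ _
      have h5 : (1 - ν) ^ 2 / t + t - 2 * |1 - ν| = (|1 - ν| - t) ^ 2 / t := by
        rw [← sq_abs (1 - ν)]; field_simp; ring
      have : 0 ≤ (|1 - ν| - t) ^ 2 / t := by positivity
      linarith
    calc X T = ν * X T + (1 - ν) * X T := by ring
      _ ≤ ((R * Q T - N T ^ 2) / m ^ 2 / (2 * t) + t / 2) + ((1 - ν) ^ 2 / t + t) := by
          refine add_le_add (h2.trans ?_) h3
          gcongr
      _ = _ := by
          rw [hNm]; field_simp; ring
  have hI1 : Integrable (fun T => (R * Q T - N T ^ 2) / (2 * t * m ^ 2)) P :=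
    ((hQ1.const_mul _).sub hNN1).div_const _
  have hI2 : Integrable (fun T => (N T ^ 2 / m ^ 2 - 2 * (N T / m)) / t) P :=
    ((hNN1.div_const _).sub ((hN1.div_const _).const_mul _)).div_const _
  have hI12 : Integrable (fun T => (R * Q T - N T ^ 2) / (2 * t * m ^ 2) +
      (N T ^ 2 / m ^ 2 - 2 * (N T / m)) / t) P := hI1.add hI2
  calc ∫ T, X T ∂P ≤ ∫ T, ((R * Q T - N T ^ 2) / (2 * t * m ^ 2) +
        (N T ^ 2 / m ^ 2 - 2 * (N T / m)) / t + (3 / 2 * t + 1 / t)) ∂P :=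
        integral_mono hXint (hI12.add (integrable_const _)) hpt
    _ = (∫ T, R * Q T ∂P - ∫ T, N T ^ 2 ∂P) / (2 * t * m ^ 2) +
        ((∫ T, N T ^ 2 ∂P) / m ^ 2 - 2) / t + (3 / 2 * t + 1 / t) := by
        rw [integral_add hI12 (integrable_const _), integral_add hI1 hI2,
          integral_div, integral_div, integral_sub (hQ1.const_mul _) hNN1,
          integral_sub (hNN1.div_const _) ((hN1.div_const _).const_mul _), integral_div,
          integral_const_mul 2, integral_div, hN2, div_self hm0.ne']
        simp
    _ = (∫ T, R * Q T ∂P) / m ^ 2 / (2 * t) + (∫ T, N T ^ 2 ∂P) / m ^ 2 / (2 * t) - 1 / t +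
        3 / 2 * t := by
        field_simp; ring
    _ ≤ (1 + t ^ 2) / (2 * t) + (1 + t ^ 2) / (2 * t) - 1 / t + 3 / 2 * t := by
        gcongr
        · rw [div_le_iff₀' (by positivity)]; exact hQ2
        · rw [div_le_iff₀' (by positivity)]; exact hNN2
    _ = 5 / 2 * t := by field_simp; ring
    _ = _ := by rw [ht]; ring

end Concentration

end RTN

end

theorem mainTheorem9 {V : Type*} [Fintype V] [DecidableEq V]
    (G : SimpleGraph V) [DecidableRel G.Adj]
    (A B C : Finset V) (hAB : Disjoint A B) (hAC : Disjoint A C) (hBC : Disjoint B C)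
    (w : G.edgeSet → ℝ) (hw : ∀ e, 0 ≤ w e)
    (g : ℝ) (hg : 0 < g)
    (hEW : ∃ r : Finset V, RTN.IsUniqueEntanglementWedge G w (A ∪ B) C g r) :
    ∃ K : ℝ, ∀ (χ : ℝ) (D : G.edgeSet → ℕ+) (Ψ : (e : G.edgeSet) → RTN.EIdx D e → ℂ),
      1 < χ →
      (∀ e, w e = Real.log (D e : ℕ) / Real.log χ) →
      (∀ e, RTN.IsMaxEntangled D e (Ψ e)) →
      Integrable
        (fun T : RTN.Tensors D (A ∪ B ∪ C) =>
          RTN.traceNorm (RTN.reducedDensity D Ψ (A ∪ B) C T -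
            ((χ ^ RTN.minCut G w (A ∪ B) C : ℝ) : ℂ)⁻¹ •
              RTN.supportProj (RTN.reducedDensity D Ψ (A ∪ B) C T)))
        (RTN.haarTensors D (A ∪ B ∪ C)) ∧
      ∫ T : RTN.Tensors D (A ∪ B ∪ C),
          RTN.traceNorm (RTN.reducedDensity D Ψ (A ∪ B) C T -
            ((χ ^ RTN.minCut G w (A ∪ B) C : ℝ) : ℂ)⁻¹ •
              RTN.supportProj (RTN.reducedDensity D Ψ (A ∪ B) C T))
          ∂(RTN.haarTensors D (A ∪ B ∪ C)) ≤ K * χ ^ (-g / 2) := by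
  obtain ⟨r₀, hr₀⟩ := hEW
  exact ⟨5 / 2 * √(2 ^ Fintype.card V), fun χ D Ψ hχ hD hΨ =>
    RTN.integral_traceNorm_le Ψ (Finset.disjoint_union_left.mpr ⟨hAC, hBC⟩) hw hr₀ hχ hD hΨ⟩
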